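/- **Setting.** Let $\alpha\in(0,1]$, $L>0$, $d\ge 0$, and for $n\ge 0$ let $\Omega_n\subset\mathbb R^d$ be open with $0\in\Omega_n$ and $f_n\colon\Omega_n\to\mathbb R^d$. Consider the following conditions, for all $n\ge0$. (C1) $f_n$ is a $C^{1+\alpha}$ diffeomorphism onto its image and $f_n(0)=0$. (C2) $\mathbb R^d=E^u_n\oplus E^s_n$ and $Df_n(0)E^\sigma_n=E^\sigma_{n+1}$ for $\sigma=u,s$. (C3) There are $\lambda^u_n,\lambda^s_n\in\mathbb R$ and $\theta_n,\beta_n>0$ such that for $v_u\in E_n^u$, $v_s\in E_n^s$: $\|Df_n(0)v_u\|\ge e^{\lambda^u_n}\|v_u\|$, $\|Df_n(0)v_s\|\le e^{\lambda^s_n}\|v_s\|$, $\measuredangle(v_u,v_s)\ge\theta_n$ if both are non-zero, and $\max(1,|Df_n|_\alpha)\le\beta_n\sin\theta_{n+1}$, where $|\cdot|_\alpha$ is the $\alpha$-Hölder seminorm over $\Omega_n$. (C4) $|\lambda^u_n|\le L$, $|\lambda^s_n|\le L$ and $\beta_{n+1}\le e^L\beta_n$. Write $B^{u}_n(r)$,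 $B^s_n(r)$ for the open ball of radius $r$ about $0$ in $E_n^{u}$, $E_n^s$. For parameters $r,\gamma>0$ condition (C5) reads: $\Omega_n\supset B^u_n(r)\times B^s_n(\gamma r)$ for all $n$. For a threshold $\bar\beta>0$ put $\Delta_n=\max(0,(\lambda^s_n-\lambda^u_n)/\alpha)$ and $\lambda^e_n=\lambda^u_n-\Delta_n$ if $\beta_n\le\bar\beta$, $\lambda_n^e=\min(\lambda^u_n-\Delta_n,\frac1\alpha\log\frac{\beta_{n-1}}{\beta_n})$ if $\beta_n>\bar\beta$ (we shall assume $\beta_0\le\bar\beta$, so this is meaningful for $n=0$). Let $$\chi^e=\varliminf_{n\to\infty}\frac1n\sum_{k=0}^{n-1}\lambda^e_k,\qquad \chi^g=\varliminf_{n\to\infty}\frac1n\sum_{k=0}^{n-1}(\lambda^u_k-\lambda^s_k).$$ The sequence is effectively hyperbolic (with threshold $\bar\beta$) if $\chi^e>0$, and the splitting is asymptotically dominated if $\chi^g>0$. Given $\hat\chi^u>0$, let $\Gamma$ be the set of effective hyperbolic times, i.e. of $n\ge1$ with $\frac1{n-k}\sum_{j=k}^{n-1}\lambda^e_j\ge\hat\chi^u$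 for all $0\le k<n$. The lower density of $\Gamma$ is $\underline\delta(\Gamma)=\varliminf_{N\to\infty}\frac1N\#(\Gamma\cap[0,N))$. Let $\hat{\mathcal C}_n(r,\kappa)$ be the set of $C^{1+\alpha}$ functions $\psi\colon B^u_n(r)\to E^s_n$ with $\psi(0)=0$, $D\psi(0)=0$, $|D\psi|_\alpha\le\kappa$. Given $r_n,\kappa_n>0$, the graph transform $G_n\colon\hat{\mathcal C}_n(r_n,\kappa_n)\to\hat{\mathcal C}_{n+1}(r_{n+1},\kappa_{n+1})$ is well defined if for each $\psi$ in the source there is exactly one $G_n\psi$ in the target whose graph is a relatively open subset of $f_n(\operatorname{graph}\psi)$. In this case put $\mathcal G_n=G_{n-1}\circ\dots\circ G_0$. Write $F_{m,n}=f_{n-1}\circ\dots\circ f_m$, put $T_k=B^u_k(r_k)\times B^s_k(\kappa_kr_k^{\alpha}\,r_k)$, and let $\Omega_m^n$ be the connected component containing $0$ of $\bigcap_{k=m}^{n-1}F_{m,k}^{-1}(T_k)$. **Theorem A.** Given $\bar\beta,L>0$, $\alpha\in(0,1]$, $\hat\chi^u>\bar\chi^u>0$ and $\hat\chi^g>\bar\chi^g>0$,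 there are $\tilde\gamma,\tilde r,\tilde\theta,\tilde\kappa>0$, depending only on these numbers, such that the following holds for all $\bar\gamma\in(0,\tilde\gamma]$, $\bar r\in(0,\tilde r]$, $\bar\theta\in(0,\tilde\theta]$, $\bar\kappa\ge\tilde\kappa$ with $\bar\kappa\bar r^\alpha\le\bar\gamma$. Let $\{f_n\mid n\ge0\}$ satisfy (C1)–(C4), (C5) with $r=\bar r$, $\gamma=\bar\kappa\bar r^\alpha$, and $\beta_0\le\bar\beta$, and suppose that it is effectively hyperbolic with $\chi^e>\hat\chi^u$ (using the threshold $\bar\beta$). Then $$\underline\delta(\Gamma)\ge\frac{\chi^e-\hat\chi^u}{L-\hat\chi^u}>0 .$$ Moreover $\theta_n\ge\bar\theta$ for every $n\in\Gamma$, and there are $r_n\in(0,\bar r]$ and $\kappa_n>0$ ($n\ge0$) with $\kappa_nr_n^\alpha\le\bar\kappa\bar r^\alpha$ for all $n$, $(r_0,\kappa_0)=(\bar r,\bar\kappa)$, and $(r_n,\kappa_n)=(\bar r,\bar\kappa)$ for all $n\in\Gamma$, such that $G_n$ is well defined for every $n\ge0$ and the following hold for every $n\in\Gamma$ and every $\psi_0\in\hat{\mathcal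 C}_0(\bar r,\bar\kappa)$, where $\psi_k=\mathcal G_k\psi_0$. 1. $\psi_n\in\hat{\mathcal C}_n(\bar r,\bar\kappa)$; that is, $\mathcal G_n$ maps $\hat{\mathcal C}_0(\bar r,\bar\kappa)$ to $\hat{\mathcal C}_n(\bar r,\bar\kappa)$, $\psi_n(0)=0$, $D\psi_n(0)=0$, $|D\psi_n|_\alpha\le\bar\kappa$; and also $\|D\psi_n\|\le\bar\gamma$. 2. $\operatorname{graph}\psi_n$ is the part of $F_{0,n}(\operatorname{graph}\psi_0\cap\Omega_0^n)$ that lies in $B^u_n(\bar r)\times E^s_n$. 3. If $0\le m\le n$ and $x,y\in\operatorname{graph}\psi_m\cap\Omega_m^n$, then $\|F_{m,n}(x)-F_{m,n}(y)\|\ge e^{(n-m)\bar\chi^u}\|x-y\|$. If in addition the splitting is asymptotically dominated with $\chi^g>\hat\chi^g$, then for all $\varphi_0,\psi_0\in\hat{\mathcal C}_0(\bar r,\bar\kappa)$, with $\varphi_n=\mathcal G_n\varphi_0$ and $\psi_n=\mathcal G_n\psi_0$, $$\varlimsup_{n\to\infty,\ n\in\Gamma}\frac1n\log\|\psi_n-\varphi_n\|_{C^0}<-\bar\chi^g\qquad(\log0=-\infty),$$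 the norm being the supremum over $B^u_n(\bar r)$. -/

import Mathlib

/-- `|g|_α ≤ C` on the set `s`: the `α`-Hölder seminorm of `g` over `s` is at most `C`. -/
def HolderSeminormLE {X Y : Type*} [NormedAddCommGroup X] [NormedAddCommGroup Y]
    (α C : ℝ) (g : X → Y) (s : Set X) : Prop :=
  ∀ x ∈ s, ∀ y ∈ s, ‖g x - g y‖ ≤ C * ‖x - y‖ ^ α

/-- `g` is of class `C^{1+α}` on the open set `s`. -/
def IsC1Alpha {X Y : Type*} [NormedAddCommGroup X] [NormedSpace ℝ X]
    [NormedAddCommGroup Y] [NormedSpace ℝ Y] (α : ℝ) (g : X → Y) (s : Set X) : Prop :=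
  ContDiffOn ℝ 1 g s ∧ ∃ C : ℝ, HolderSeminormLE α C (fderiv ℝ g) s

/-- The data of a one-sided sequence of maps `f n : Ω n → ℝ^d`, `n ≥ 0`, with splittings
`ℝ^d = Eu n ⊕ Es n` and numbers `lu n`, `ls n`, `θ n`, `β n`. Only the values of `f n` on
`Ω n` matter. No property is imposed here. -/
structure MapSequence (d : ℕ) where
  Ω : ℕ → Set (EuclideanSpace ℝ (Fin d))
  f : ℕ → EuclideanSpace ℝ (Fin d) → EuclideanSpace ℝ (Fin d)
  Eu : ℕ → Submodule ℝ (EuclideanSpace ℝ (Fin d))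
  Es : ℕ → Submodule ℝ (EuclideanSpace ℝ (Fin d))
  lu : ℕ → ℝ
  ls : ℕ → ℝ
  θ : ℕ → ℝ
  β : ℕ → ℝ

namespace MapSequence

variable {d : ℕ} (S : MapSequence d)

/-- (C1): each `f n` is a `C^{1+α}` diffeomorphism of the open set `Ω n ∋ 0` onto its image,
fixing the origin. -/
def C1 (α : ℝ) : Prop :=
  ∀ n, IsOpen (S.Ω n) ∧ (0 : EuclideanSpace ℝ (Fin d)) ∈ S.Ω n ∧
    IsC1Alpha α (S.f n) (S.Ω n) ∧ Set.InjOn (S.f n) (S.Ω n) ∧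
    (∀ x ∈ S.Ω n, (fderiv ℝ (S.f n) x).IsInvertible) ∧ S.f n 0 = 0

/-- (C2): `ℝ^d = Eu n ⊕ Es n`, invariant under `D(f n)(0)`. -/
def C2 : Prop :=
  ∀ n, IsCompl (S.Eu n) (S.Es n) ∧
    (S.Eu n).map (fderiv ℝ (S.f n) 0).toLinearMap = S.Eu (n + 1) ∧
    (S.Es n).map (fderiv ℝ (S.f n) 0).toLinearMap = S.Es (n + 1)

/-- (C3): the bounds on expansion, contraction, angles and the Hölder seminorm; the last two
clauses say `max(1, |D(f n)|_α) ≤ β n * sin (θ (n + 1))`. -/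
def C3 (α : ℝ) : Prop :=
  ∀ n, 0 < S.θ n ∧ 0 < S.β n ∧
    (∀ v ∈ S.Eu n, Real.exp (S.lu n) * ‖v‖ ≤ ‖fderiv ℝ (S.f n) 0 v‖) ∧
    (∀ w ∈ S.Es n, ‖fderiv ℝ (S.f n) 0 w‖ ≤ Real.exp (S.ls n) * ‖w‖) ∧
    (∀ v ∈ S.Eu n, ∀ w ∈ S.Es n, v ≠ 0 → w ≠ 0 → S.θ n ≤ InnerProductGeometry.angle v w) ∧
    1 ≤ S.β n * Real.sin (S.θ (n + 1)) ∧
    HolderSeminormLE α (S.β n * Real.sin (S.θ (n + 1))) (fderiv ℝ (S.f n)) (S.Ω n)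

/-- (C4): uniform bounds on the rates and on the growth of `β`. -/
def C4 (L : ℝ) : Prop :=
  ∀ n, |S.lu n| ≤ L ∧ |S.ls n| ≤ L ∧ S.β (n + 1) ≤ Real.exp L * S.β n

/-- The box `B^u_n(r) × B^s_n(ρ)` in the coordinates given by `Eu n ⊕ Es n` (open balls). -/
def box (n : ℕ) (r ρ : ℝ) : Set (EuclideanSpace ℝ (Fin d)) :=
  {x | ∃ v ∈ S.Eu n, ∃ w ∈ S.Es n, ‖v‖ < r ∧ ‖w‖ < ρ ∧ x = v + w}

/-- The cylinder `B^u_n(r) × Es n` of the points whose `u`-coordinate has norm less than `r`. -/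
def cylinder (n : ℕ) (r : ℝ) : Set (EuclideanSpace ℝ (Fin d)) :=
  {x | ∃ v ∈ S.Eu n, ∃ w ∈ S.Es n, ‖v‖ < r ∧ x = v + w}

/-- (C5) for the parameters `τ = 0`, `r`, `γ`: `Ω n ⊇ B^u_n(r) × B^s_n(γ r)` for all `n`. -/
def C5 (r γ : ℝ) : Prop :=
  ∀ n, S.box n r (γ * r) ⊆ S.Ω n

/-- `f (m + j - 1) ∘ ⋯ ∘ f m`. -/
def compFrom (m : ℕ) : ℕ → EuclideanSpace ℝ (Fin d) → EuclideanSpace ℝ (Fin d)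
  | 0 => id
  | j + 1 => S.f (m + j) ∘ compFrom m j

/-- `F_{m,n} = f (n - 1) ∘ ⋯ ∘ f m` for `m ≤ n`. -/
def F (m n : ℕ) : EuclideanSpace ℝ (Fin d) → EuclideanSpace ℝ (Fin d) :=
  S.compFrom m (n - m)

/-- For domains `D k ⊆ Ω k`: the connected component containing `0` of
`⋂_{m ≤ k < n} F_{m,k}⁻¹ (D k)`. -/
def orbitDomain (D : ℕ → Set (EuclideanSpace ℝ (Fin d))) (m n : ℕ) :
    Set (EuclideanSpace ℝ (Fin d)) :=
  connectedComponentIn {x | ∀ k, m ≤ k → k < n → S.F m k x ∈ D k} 0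

/-- The defect from domination. -/
noncomputable def defect (α : ℝ) (n : ℕ) : ℝ :=
  max 0 ((S.ls n - S.lu n) / α)

/-- The effective rate `λ^e_n` with threshold `βbar`. It is only used when `β 0 ≤ βbar`, so
that the truncated index `n - 1` is never evaluated at `n = 0`. -/
noncomputable def lamE (α βbar : ℝ) (n : ℕ) : ℝ :=
  if S.β n ≤ βbar then S.lu n - S.defect α n
  else min (S.lu n - S.defect α n) (1 / α * Real.log (S.β (n - 1) / S.β n))

/-- `χ^e`: lower asymptotic average of `λ^e` (the averages are bounded under (C4)). -/
noncomputable def chiE (α βbar : ℝ) : ℝ :=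
  Filter.liminf (fun n : ℕ => 1 / (n : ℝ) * ∑ k ∈ Finset.range n, S.lamE α βbar k) Filter.atTop

/-- `χ^g`: lower asymptotic average of `λ^u - λ^s`. -/
noncomputable def chiG : ℝ :=
  Filter.liminf (fun n : ℕ => 1 / (n : ℝ) * ∑ k ∈ Finset.range n, (S.lu k - S.ls k)) Filter.atTop

/-- The set of effective hyperbolic times `n ≥ 1`, with thresholds `βbar` and `χ`. -/
def effHypTimes (α βbar χ : ℝ) : Set ℕ :=
  {n | 0 < n ∧ ∀ k < n, χ ≤ 1 / ((n : ℝ) - (k : ℝ)) * ∑ j ∈ Finset.Ico k n, S.lamE α βbar j}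

/-- The admissible functions `Ĉ_n(r, κ)`. A function `ψ : B^u_n(r) → Es n` is represented by a
function on `Eu n` of which only the restriction to the open ball `B^u_n(r)` matters. -/
def CHat (α : ℝ) (n : ℕ) (r κ : ℝ) (ψ : S.Eu n → S.Es n) : Prop :=
  IsC1Alpha α ψ (Metric.ball 0 r) ∧ ψ 0 = 0 ∧ fderiv ℝ ψ 0 = 0 ∧
    HolderSeminormLE α κ (fderiv ℝ ψ) (Metric.ball 0 r)

/-- The graph of `ψ : B^u_n(r) → Es n`, as a subset of `ℝ^d`. -/
def graph (n : ℕ) (r : ℝ) (ψ : S.Eu n → S.Es n) : Set (EuclideanSpace ℝ (Fin d)) :=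
  {x | ∃ v : S.Eu n, ‖v‖ < r ∧ x = (v : EuclideanSpace ℝ (Fin d)) + (ψ v)}

/-- `ψ' = G_n ψ`, for parameter sequences `r`, `κ`: `ψ'` belongs to `Ĉ_{n+1}` and its graph is a
relatively open subset of the image under `f n` of the graph of `ψ`. -/
def IsGraphTransform (α : ℝ) (r κ : ℕ → ℝ) (n : ℕ) (ψ : S.Eu n → S.Es n)
    (ψ' : S.Eu (n + 1) → S.Es (n + 1)) : Prop :=
  S.CHat α (n + 1) (r (n + 1)) (κ (n + 1)) ψ' ∧
    ∃ U : Set (EuclideanSpace ℝ (Fin d)), IsOpen U ∧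
      S.graph (n + 1) (r (n + 1)) ψ' = S.f n '' S.graph n (r n) ψ ∩ U

/-- The graph transform `G_n : Ĉ_n(r n, κ n) → Ĉ_{n+1}(r (n+1), κ (n+1))` is well defined:
the image exists and is unique as a function on the ball of radius `r (n + 1)`. -/
def GraphTransformDefined (α : ℝ) (r κ : ℕ → ℝ) (n : ℕ) : Prop :=
  ∀ ψ : S.Eu n → S.Es n, S.CHat α n (r n) (κ n) ψ →
    ∃ ψ', S.IsGraphTransform α r κ n ψ ψ' ∧
      ∀ ψ'', S.IsGraphTransform α r κ n ψ ψ'' → Set.EqOn ψ' ψ'' (Metric.ball 0 (r (n + 1)))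

/-- `ψ n = 𝒢_n (ψ 0)` for all `n`, where `𝒢_n = G_{n-1} ∘ ⋯ ∘ G_0` and `ψ 0 ∈ Ĉ_0(r 0, κ 0)`. -/
def IsGraphTransformOrbit (α : ℝ) (r κ : ℕ → ℝ) (ψ : ∀ n, S.Eu n → S.Es n) : Prop :=
  S.CHat α 0 (r 0) (κ 0) (ψ 0) ∧ ∀ n, S.IsGraphTransform α r κ n (ψ n) (ψ (n + 1))

/-- The `C^0` distance `‖ψ - φ‖` over the ball `B^u_n(r)`, with values in `[0, ∞]`. -/
noncomputable def c0Dist (n : ℕ) (r : ℝ) (ψ φ : S.Eu n → S.Es n) : ENNReal :=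
  ⨆ v ∈ Metric.ball (0 : S.Eu n) r, ‖ψ v - φ v‖ₑ

end MapSequence

/-- The lower asymptotic density of a set of natural numbers. -/
noncomputable def lowerDensity (Γ : Set ℕ) : ℝ :=
  Filter.liminf (fun N : ℕ => 1 / (N : ℝ) * ((Γ ∩ Set.Iio N).ncard : ℝ)) Filter.atTop

/-! In the coordinates `Eu n × Es n` each map is a perturbation of a diagonal linear map, and on a
box of radius `r` its derivative varies by a multiple of `β n * r ^ α`. If this variation is small,
the graph transform is defined; up to a loss `η` in the exponents, the domain radius may grow by the
factor `exp (lu n)`, and the Hölder constant of the derivative is multiplied by at most `exp (ls n -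
(1 + α) * lu n)`.

The radii and Hölder constants are coupled by keeping `κ n * r n ^ α` equal to one fixed slope, and
`r (n + 1)` is the minimum of `rbar` and `exp (λ^e_n - δ) * r n`. Each part of the effective rate
serves one requirement: `λ^e ≤ λ^u` makes the new domain small enough to be covered, the defect `Δ`
controls the new Hölder constant, and the term with `log (β (n - 1) / β n)` keeps `β n * r n ^ α`
bounded, so that one `ε` bounds the nonlinearity at all times. The margin `δ = 3 * η / α` pays for
the losses `η`. This is `admissibleRadii_radius`, resting on `isAdmissible_graphTransform` and
`hyperbolicStep`.

At an effective hyperbolic time all sums of `λ^e - δ` over intervals ending there are nonnegative,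
so the radius has recovered to `rbar`. The same recursion bounds `β (n - 1)` by `βbar` there, hence
the angle from below. Pliss' lemma gives the density of these times.

The expansion follows from the growth of the `u`-coordinate along the graphs (`expand_F`), the
convergence from the contraction of the distance between two graphs relative to `‖v‖`
(`norm_sub_le_exp`). -/

open Set Metric Filter Topology

/-! ### One step of the graph transform in product coordinates. -/

section GraphTransformStep

variable {X Y : Type*} [NormedAddCommGroup X] [NormedSpace ℝ X]
  [NormedAddCommGroup Y] [NormedSpace ℝ Y]

/-- `g` vanishes at the origin, has derivative `T` there, and its derivative is `α`-Hölder with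
constant `H` on `K`. -/
structure HasHolderDeriv (α H : ℝ) (T : X →L[ℝ] Y) (g : X → Y) (K : Set X) : Prop where
  differentiableAt : ∀ x ∈ K, DifferentiableAt ℝ g x
  fderiv_zero : fderiv ℝ g 0 = T
  map_zero : g 0 = 0
  holder : HolderSeminormLE α H (fderiv ℝ g) K

/-- The functions `ψ` with `ψ 0 = 0`, `Dψ 0 = 0` and `|Dψ|_α ≤ κ` on the ball of radius `r`. -/
def IsAdmissible (α r κ : ℝ) (ψ : X → Y) : Prop :=
  IsC1Alpha α ψ (ball 0 r) ∧ ψ 0 = 0 ∧ fderiv ℝ ψ 0 = 0 ∧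
    HolderSeminormLE α κ (fderiv ℝ ψ) (ball 0 r)

omit [NormedSpace ℝ X] [NormedSpace ℝ Y] in
lemma HolderSeminormLE.continuousOn {α C : ℝ} (hα : 0 < α) {g : X → Y} {s : Set X}
    (h : HolderSeminormLE α C g s) : ContinuousOn g s := by
  intro x hx
  rw [ContinuousWithinAt, tendsto_iff_norm_sub_tendsto_zero]
  have h1 : Tendsto (fun y => C * ‖y - x‖ ^ α) (𝓝[s] x) (𝓝 0) := by
    have : Continuous (fun y : X => C * ‖y - x‖ ^ α) :=
      continuous_const.mul ((continuous_id.sub continuous_const).norm.rpow_const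
        (fun _ => Or.inr hα.le))
    have h2 := (this.tendsto x).mono_left (nhdsWithin_le_nhds (s := s))
    simpa [Real.zero_rpow hα.ne'] using h2
  refine squeeze_zero' (Eventually.of_forall fun _ => norm_nonneg _) ?_ h1
  filter_upwards [self_mem_nhdsWithin] with y hy using h y hy x hx

lemma contDiffOn_one_of_holder {α C : ℝ} (hα : 0 < α) {g : X → Y} {s : Set X} (hs : IsOpen s)
    (hd : ∀ x ∈ s, DifferentiableAt ℝ g x) (h : HolderSeminormLE α C (fderiv ℝ g) s) :
    ContDiffOn ℝ 1 g s := by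
  have := (contDiffOn_succ_iff_fderiv_of_isOpen (𝕜 := ℝ) (f := g) (n := 0) hs).2
    ⟨fun x hx => (hd x hx).differentiableWithinAt, by simp,
      contDiffOn_zero.2 (h.continuousOn hα)⟩
  simpa using this

namespace IsAdmissible

variable {α r κ : ℝ} {ψ φ : X → Y}

lemma differentiableAt (h : IsAdmissible α r κ ψ) {v : X} (hv : v ∈ ball 0 r) :
    DifferentiableAt ℝ ψ v :=
  (h.1.1.differentiableOn (by simp)).differentiableAt (isOpen_ball.mem_nhds hv)

lemma norm_fderiv_le (h : IsAdmissible α r κ ψ) (hα : 0 < α) (hκ : 0 ≤ κ) {v : X}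
    (hv : v ∈ ball 0 r) : ‖fderiv ℝ ψ v‖ ≤ κ * r ^ α := by
  have hr : ‖v‖ < r := by simpa using hv
  have h0 : (0 : X) ∈ ball (0 : X) r := mem_ball_self ((norm_nonneg v).trans_lt hr)
  have := h.2.2.2 v hv 0 h0
  rw [h.2.2.1, sub_zero, sub_zero] at this
  refine this.trans (mul_le_mul_of_nonneg_left ?_ hκ)
  exact Real.rpow_le_rpow (norm_nonneg _) hr.le hα.le

lemma norm_sub_le (h : IsAdmissible α r κ ψ) (hα : 0 < α) (hκ : 0 ≤ κ) {v w : X}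
    (hv : v ∈ ball 0 r) (hw : w ∈ ball 0 r) : ‖ψ v - ψ w‖ ≤ κ * r ^ α * ‖v - w‖ :=
  Convex.norm_image_sub_le_of_norm_fderiv_le (𝕜 := ℝ) (fun _ hx => h.differentiableAt hx)
    (fun _ hx => h.norm_fderiv_le hα hκ hx) (convex_ball 0 r) hw hv

lemma norm_le (h : IsAdmissible α r κ ψ) (hα : 0 < α) (hκ : 0 ≤ κ) {v : X}
    (hv : v ∈ ball 0 r) : ‖ψ v‖ ≤ κ * r ^ α * ‖v‖ := by
  have hr : ‖v‖ < r := by simpa using hv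
  have h0 : (0 : X) ∈ ball (0 : X) r := mem_ball_self ((norm_nonneg v).trans_lt hr)
  simpa [h.2.1] using h.norm_sub_le hα hκ hv h0

lemma norm_lt (h : IsAdmissible α r κ ψ) (hα : 0 < α) (hκ : 0 < κ) {v : X}
    (hv : v ∈ ball 0 r) : ‖ψ v‖ < κ * r ^ α * r := by
  have hr : ‖v‖ < r := by simpa using hv
  have hr0 := (norm_nonneg v).trans_lt hr
  exact (h.norm_le hα hκ.le hv).trans_lt (by gcongr)

end IsAdmissible

variable {U W U' W' : Type*} [NormedAddCommGroup U] [NormedSpace ℝ U]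
  [NormedAddCommGroup W] [NormedSpace ℝ W] [NormedAddCommGroup U'] [NormedSpace ℝ U']
  [NormedAddCommGroup W'] [NormedSpace ℝ W']

/-- A map `(fu, fs) : U × W → U' × W'` that is close, on the product of the balls of radii `r` and
`γ * r`, to the product of the linear maps `A` and `B`, of which `A` expands by `a` and `B` has norm
at most `b`; the smallness conditions are those under which the graph transform sends admissible
functions with parameters `r`, `κ` to admissible functions with parameters `r'`, `κ'`. -/
structure HyperbolicStep (α H ε a b b' r κ γ r' κ' : ℝ) (A : U →L[ℝ] U') (B : W →L[ℝ] W')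
    (fu : U × W → U') (fs : U × W → W') : Prop where
  u : HasHolderDeriv α H (A.comp (ContinuousLinearMap.fst ℝ U W)) fu
    (ball (0 : U) r ×ˢ ball (0 : W) (γ * r))
  s : HasHolderDeriv α H (B.comp (ContinuousLinearMap.snd ℝ U W)) fs
    (ball (0 : U) r ×ˢ ball (0 : W) (γ * r))
  expand : ∀ v, a * ‖v‖ ≤ ‖A v‖
  contract : ∀ w, ‖B w‖ ≤ b * ‖w‖
  surjective : Function.Surjective A
  α_pos : 0 < α
  H_nonneg : 0 ≤ H
  ε_pos : 0 < ε
  ε_lt : ε < a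
  b_nonneg : 0 ≤ b
  r_pos : 0 < r
  κ_pos : 0 < κ
  r'_pos : 0 < r'
  κ_mul : κ * r ^ α = γ
  γ_le_one : γ ≤ 1
  small : H * r ^ α ≤ ε
  H_le : H ≤ ε * κ
  r'_le : r' ≤ (a - ε) * r
  b_le : b + 2 * ε + 2 * ε * (b * γ + ε) / (a - ε) ≤ b'
  κ'_ge : b' * κ * (a - ε) ^ (-1 - α) ≤ κ'

namespace HyperbolicStep

variable {α H ε a b b' r κ γ r' κ' : ℝ} {A : U →L[ℝ] U'} {B : W →L[ℝ] W'}
    {fu : U × W → U'} {fs : U × W → W'} {ψ φ : U → W}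

variable (h : HyperbolicStep α H ε a b b' r κ γ r' κ' A B fu fs)

include h

lemma γ_pos : 0 < γ := by
  rw [← h.κ_mul]
  exact mul_pos h.κ_pos (Real.rpow_pos_of_pos h.r_pos α)

lemma c_pos : 0 < a - ε := sub_pos.2 h.ε_lt

lemma zero_mem : (0 : U × W) ∈ ball (0 : U) r ×ˢ ball (0 : W) (γ * r) :=
  ⟨mem_ball_self h.r_pos, mem_ball_self (mul_pos h.γ_pos h.r_pos)⟩

lemma norm_lt_of_mem {x : U × W} (hx : x ∈ ball (0 : U) r ×ˢ ball (0 : W) (γ * r)) : ‖x‖ < r := by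
  have h1 : ‖x.1‖ < r := by simpa using hx.1
  have h2 : ‖x.2‖ < γ * r := by simpa using hx.2
  rw [Prod.norm_def, max_lt_iff]
  exact ⟨h1, h2.trans_le (mul_le_of_le_one_left h.r_pos.le h.γ_le_one)⟩

lemma norm_fderiv_sub_le {V : Type*} [NormedAddCommGroup V] [NormedSpace ℝ V]
    {T : U × W →L[ℝ] V} {g : U × W → V}
    (hg : HasHolderDeriv α H T g (ball (0 : U) r ×ˢ ball (0 : W) (γ * r)))
    {x : U × W} (hx : x ∈ ball (0 : U) r ×ˢ ball (0 : W) (γ * r)) :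
    ‖fderiv ℝ g x - T‖ ≤ ε := by
  have h1 := hg.holder x hx 0 h.zero_mem
  rw [hg.fderiv_zero, sub_zero] at h1
  refine h1.trans ((mul_le_mul_of_nonneg_left ?_ h.H_nonneg).trans h.small)
  exact Real.rpow_le_rpow (norm_nonneg _) (h.norm_lt_of_mem hx).le h.α_pos.le

/-- The mean value inequality for `g - T` on the convex box, where the Hölder bound and `H * r ^ α ≤
ε` make the derivative `ε`-close to `T`. -/
lemma norm_sub_sub_le {V : Type*} [NormedAddCommGroup V] [NormedSpace ℝ V]
    {T : U × W →L[ℝ] V} {g : U × W → V}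
    (hg : HasHolderDeriv α H T g (ball (0 : U) r ×ˢ ball (0 : W) (γ * r)))
    {x y : U × W} (hx : x ∈ ball (0 : U) r ×ˢ ball (0 : W) (γ * r))
    (hy : y ∈ ball (0 : U) r ×ˢ ball (0 : W) (γ * r)) :
    ‖g x - g y - T (x - y)‖ ≤ ε * ‖x - y‖ :=
  Convex.norm_image_sub_le_of_norm_fderiv_le' (𝕜 := ℝ) hg.differentiableAt
    (fun _ hz => h.norm_fderiv_sub_le hg hz) ((convex_ball _ _).prod (convex_ball _ _)) hy hx

variable (hψ : IsAdmissible α r κ ψ)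

include hψ

lemma graph_mem {v : U} (hv : v ∈ ball (0 : U) r) :
    (v, ψ v) ∈ ball (0 : U) r ×ˢ ball (0 : W) (γ * r) := by
  refine ⟨hv, ?_⟩
  have := hψ.norm_lt h.α_pos h.κ_pos hv
  rw [h.κ_mul] at this
  simpa using this

/-- The product carries the maximum norm and the slope of the graph is at most `γ ≤ 1`, so the
`u`-component dominates. -/
lemma norm_graph_sub {v w : U} (hv : v ∈ ball (0 : U) r) (hw : w ∈ ball (0 : U) r) :
    ‖((v, ψ v) : U × W) - (w, ψ w)‖ = ‖v - w‖ := by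
  have h1 := hψ.norm_sub_le h.α_pos h.κ_pos.le hv hw
  rw [h.κ_mul] at h1
  have h2 := h1.trans (mul_le_of_le_one_left (norm_nonneg _) h.γ_le_one)
  rw [Prod.norm_def]
  exact max_eq_left h2

lemma norm_u_sub_sub_le {v w : U} (hv : v ∈ ball (0 : U) r) (hw : w ∈ ball (0 : U) r) :
    ‖fu (v, ψ v) - fu (w, ψ w) - A (v - w)‖ ≤ ε * ‖v - w‖ := by
  have := h.norm_sub_sub_le h.u (h.graph_mem hψ hv) (h.graph_mem hψ hw)
  rw [h.norm_graph_sub hψ hv hw] at this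
  simpa using this

lemma expand_graph {v w : U} (hv : v ∈ ball (0 : U) r) (hw : w ∈ ball (0 : U) r) :
    (a - ε) * ‖v - w‖ ≤ ‖fu (v, ψ v) - fu (w, ψ w)‖ := by
  have h1 := h.norm_u_sub_sub_le hψ hv hw
  have h2 := h.expand (v - w)
  have h3 := norm_sub_norm_le (A (v - w)) (A (v - w) - (fu (v, ψ v) - fu (w, ψ w)))
  rw [sub_sub_cancel, norm_sub_rev (A (v - w))] at h3
  linarith

lemma norm_s_sub_le {v w : U} (hv : v ∈ ball (0 : U) r) (hw : w ∈ ball (0 : U) r) :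
    ‖fs (v, ψ v) - fs (w, ψ w)‖ ≤ (b * γ + ε) * ‖v - w‖ := by
  have h1 := h.norm_sub_sub_le h.s (h.graph_mem hψ hv) (h.graph_mem hψ hw)
  rw [h.norm_graph_sub hψ hv hw] at h1
  have h2 : ‖B (ψ v - ψ w)‖ ≤ b * (γ * ‖v - w‖) := by
    refine (h.contract _).trans (mul_le_mul_of_nonneg_left ?_ h.b_nonneg)
    have := hψ.norm_sub_le h.α_pos h.κ_pos.le hv hw
    rwa [h.κ_mul] at this
  have h3 := norm_sub_norm_le (fs (v, ψ v) - fs (w, ψ w)) (B (ψ v - ψ w))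
  have h4 : ‖fs (v, ψ v) - fs (w, ψ w) - B (ψ v - ψ w)‖ ≤ ε * ‖v - w‖ := by simpa using h1
  nlinarith

lemma injOn_graph : InjOn (fun v => fu (v, ψ v)) (ball (0 : U) r) := by
  intro v hv w hw hvw
  have := h.expand_graph hψ hv hw
  simp only at hvw
  rw [hvw, sub_self, norm_zero] at this
  have h1 := h.c_pos
  have h2 : ‖v - w‖ ≤ 0 := by
    by_contra! hc
    nlinarith
  exact sub_eq_zero.1 (norm_le_zero_iff.1 h2)

/-- The quantitative inverse function theorem: an `ε`-perturbation of a surjection expanding by `a`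
covers the ball of radius `(a - ε) * s` around the image of the centre of a ball of radius `s`. It
is applied on a closed ball of radius `‖y‖ / (a - ε) < r`. -/
lemma surjOn_graph [CompleteSpace U] :
    SurjOn (fun v => fu (v, ψ v)) (ball (0 : U) r) (ball (0 : U') r') := by
  have ha : 0 < a := h.ε_pos.trans h.ε_lt
  intro y hy
  have hy' : ‖y‖ < (a - ε) * r := (by simpa using hy : ‖y‖ < r').trans_le h.r'_le
  have hc := h.c_pos
  have happ : ApproximatesLinearOn (fun v => fu (v, ψ v)) A (ball (0 : U) r) ⟨ε, h.ε_pos.le⟩ :=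
    fun v hv w hw => h.norm_u_sub_sub_le hψ hv hw
  let R : A.NonlinearRightInverse :=
    { toFun := Function.surjInv h.surjective
      nnnorm := ⟨a⁻¹, (inv_pos.2 ha).le⟩
      bound' := fun z => by
        have := h.expand (Function.surjInv h.surjective z)
        rw [Function.surjInv_eq h.surjective] at this
        change _ ≤ a⁻¹ * ‖z‖
        rw [inv_mul_eq_div, le_div_iff₀ ha, mul_comm]
        exact this
      right_inv' := Function.surjInv_eq h.surjective }
  have hs : ‖y‖ / (a - ε) < r := by rwa [div_lt_iff₀ hc, mul_comm]
  have := happ.surjOn_closedBall_of_nonlinearRightInverse R (ε := ‖y‖ / (a - ε)) (b := 0)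
    (by positivity) (closedBall_subset_ball hs)
  have e : ((R.nnnorm : ℝ)⁻¹ - ε) = a - ε := by
    change (a⁻¹)⁻¹ - ε = _
    rw [inv_inv]
  obtain ⟨v, hv, hvy⟩ := this (show y ∈ _ by
    change y ∈ closedBall (fu (0, ψ 0)) (((R.nnnorm : ℝ)⁻¹ - ε) * _)
    rw [e, mul_div_cancel₀ _ hc.ne', hψ.2.1, mem_closedBall, show ((0, 0) : U × W) = 0 from rfl,
      h.u.map_zero, dist_zero_right])
  exact ⟨v, closedBall_subset_ball hs hv, hvy⟩

omit h hψ in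
/-- The inverse of `v ↦ fu (v, ψ v)` on the ball of radius `r`. -/
noncomputable def _root_.graphPullback (r : ℝ) (fu : U × W → U') (ψ : U → W) : U' → U :=
  Function.invFunOn (fun v => fu (v, ψ v)) (ball (0 : U) r)

omit h hψ in
/-- The graph transform of `ψ` under `(fu, fs)`. -/
noncomputable def _root_.graphTransform (r : ℝ) (fu : U × W → U') (fs : U × W → W') (ψ : U → W) :
    U' → W' :=
  fun y => fs (graphPullback r fu ψ y, ψ (graphPullback r fu ψ y))

lemma pullback_mem [CompleteSpace U] {y : U'} (hy : y ∈ ball (0 : U') r') :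
    graphPullback r fu ψ y ∈ ball (0 : U) r :=
  Function.invFunOn_mem (h.surjOn_graph hψ hy)

lemma apply_pullback [CompleteSpace U] {y : U'} (hy : y ∈ ball (0 : U') r') :
    fu (graphPullback r fu ψ y, ψ (graphPullback r fu ψ y)) = y :=
  Function.invFunOn_eq (f := fun v => fu (v, ψ v)) (h.surjOn_graph hψ hy)

lemma pullback_apply [CompleteSpace U] {v : U} (hv : v ∈ ball (0 : U) r) :
    graphPullback r fu ψ (fu (v, ψ v)) = v :=
  h.injOn_graph hψ (Function.invFunOn_mem ⟨v, hv, rfl⟩) hv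
    (Function.invFunOn_eq (f := fun v => fu (v, ψ v)) ⟨v, hv, rfl⟩)

lemma pullback_zero [CompleteSpace U] : graphPullback r fu ψ 0 = 0 := by
  have := h.pullback_apply hψ (mem_ball_self h.r_pos)
  rwa [hψ.2.1, show ((0, 0) : U × W) = 0 from rfl, h.u.map_zero] at this

lemma norm_pullback_sub_le [CompleteSpace U] {y z : U'} (hy : y ∈ ball (0 : U') r')
    (hz : z ∈ ball (0 : U') r') :
    ‖graphPullback r fu ψ y - graphPullback r fu ψ z‖ ≤ (a - ε)⁻¹ * ‖y - z‖ := by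
  have := h.expand_graph hψ (h.pullback_mem hψ hy) (h.pullback_mem hψ hz)
  rw [h.apply_pullback hψ hy, h.apply_pullback hψ hz] at this
  rw [inv_mul_eq_div, le_div_iff₀ h.c_pos, mul_comm]
  exact this

lemma continuousOn_pullback [CompleteSpace U] :
    ContinuousOn (graphPullback r fu ψ) (ball (0 : U') r') := by
  refine LipschitzOnWith.continuousOn (K := ⟨(a - ε)⁻¹, (inv_pos.2 h.c_pos).le⟩) ?_
  refine LipschitzOnWith.of_dist_le_mul fun y hy z hz => ?_
  rw [dist_eq_norm, dist_eq_norm]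
  exact h.norm_pullback_sub_le hψ hy hz

lemma hasFDerivAt_comp_graph {V : Type*} [NormedAddCommGroup V] [NormedSpace ℝ V]
    {g : U × W → V} (hg : ∀ x ∈ ball (0 : U) r ×ˢ ball (0 : W) (γ * r), DifferentiableAt ℝ g x)
    {v : U} (hv : v ∈ ball (0 : U) r) :
    HasFDerivAt (fun v => g (v, ψ v))
      ((fderiv ℝ g (v, ψ v)).comp ((ContinuousLinearMap.id ℝ U).prod (fderiv ℝ ψ v))) v :=
  HasFDerivAt.comp v (hg _ (h.graph_mem hψ hv)).hasFDerivAt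
    ((hasFDerivAt_id v).prodMk (hψ.differentiableAt hv).hasFDerivAt)

lemma norm_graph_tangent {v : U} (hv : v ∈ ball (0 : U) r) (u : U) :
    ‖((u, fderiv ℝ ψ v u) : U × W)‖ = ‖u‖ := by
  have h1 := (fderiv ℝ ψ v).le_of_opNorm_le (hψ.norm_fderiv_le h.α_pos h.κ_pos.le hv) u
  rw [h.κ_mul] at h1
  have h2 := h1.trans (mul_le_of_le_one_left (norm_nonneg _) h.γ_le_one)
  rw [Prod.norm_def]
  exact max_eq_left h2

lemma norm_fderiv_tangent_sub_le {V : Type*} [NormedAddCommGroup V] [NormedSpace ℝ V]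
    {T : U × W →L[ℝ] V} {g : U × W → V}
    (hg : HasHolderDeriv α H T g (ball (0 : U) r ×ˢ ball (0 : W) (γ * r)))
    {v : U} (hv : v ∈ ball (0 : U) r) (u : U) :
    ‖fderiv ℝ g (v, ψ v) (u, fderiv ℝ ψ v u) - T (u, fderiv ℝ ψ v u)‖ ≤ ε * ‖u‖ := by
  have := (fderiv ℝ g (v, ψ v) - T).le_of_opNorm_le
    (h.norm_fderiv_sub_le hg (h.graph_mem hψ hv)) (u, fderiv ℝ ψ v u)
  rwa [h.norm_graph_tangent hψ hv] at this

lemma expand_tangent {v : U} (hv : v ∈ ball (0 : U) r) (u : U) :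
    (a - ε) * ‖u‖ ≤ ‖fderiv ℝ fu (v, ψ v) (u, fderiv ℝ ψ v u)‖ := by
  have h1 := h.norm_fderiv_tangent_sub_le hψ h.u hv u
  have h2 := h.expand u
  have h3 := norm_sub_norm_le (A u) (A u - fderiv ℝ fu (v, ψ v) (u, fderiv ℝ ψ v u))
  rw [sub_sub_cancel, norm_sub_rev (A u)] at h3
  simp only [ContinuousLinearMap.comp_apply, ContinuousLinearMap.coe_fst'] at h1
  linarith

lemma norm_s_tangent_le {v : U} (hv : v ∈ ball (0 : U) r) (u : U) :
    ‖fderiv ℝ fs (v, ψ v) (u, fderiv ℝ ψ v u)‖ ≤ (b * γ + ε) * ‖u‖ := by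
  have h1 := h.norm_fderiv_tangent_sub_le hψ h.s hv u
  have h2 : ‖B (fderiv ℝ ψ v u)‖ ≤ b * (γ * ‖u‖) := by
    refine (h.contract _).trans (mul_le_mul_of_nonneg_left ?_ h.b_nonneg)
    have := (fderiv ℝ ψ v).le_of_opNorm_le (hψ.norm_fderiv_le h.α_pos h.κ_pos.le hv) u
    rwa [h.κ_mul] at this
  have h3 := norm_sub_norm_le (fderiv ℝ fs (v, ψ v) (u, fderiv ℝ ψ v u)) (B (fderiv ℝ ψ v u))
  simp only [ContinuousLinearMap.comp_apply, ContinuousLinearMap.coe_snd'] at h1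
  nlinarith

/-- Moving the base point changes both `Dg` and the tangent vector. The first change costs `H`; the
second is a vertical vector of size at most `κ * ‖v - w‖ ^ α * ‖u‖`, on which `Dg` has norm at most
`t + ε`. It is used with `t = 0` for `fu` and `t = b` for `fs`. -/
lemma norm_tangent_map_sub_le {V : Type*} [NormedAddCommGroup V] [NormedSpace ℝ V]
    {T : U × W →L[ℝ] V} {g : U × W → V} {t : ℝ}
    (hg : HasHolderDeriv α H T g (ball (0 : U) r ×ˢ ball (0 : W) (γ * r)))
    (hT : ∀ w, ‖T (0, w)‖ ≤ t * ‖w‖) (ht : 0 ≤ t)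
    {v w : U} (hv : v ∈ ball (0 : U) r) (hw : w ∈ ball (0 : U) r) (u : U) :
    ‖fderiv ℝ g (v, ψ v) (u, fderiv ℝ ψ v u) - fderiv ℝ g (w, ψ w) (u, fderiv ℝ ψ w u)‖ ≤
      (H + (t + ε) * κ) * ‖v - w‖ ^ α * ‖u‖ := by
  have hε := h.ε_pos
  have h1 := (fderiv ℝ g (v, ψ v) - fderiv ℝ g (w, ψ w)).le_of_opNorm_le
    (hg.holder _ (h.graph_mem hψ hv) _ (h.graph_mem hψ hw)) (u, fderiv ℝ ψ v u)
  rw [h.norm_graph_tangent hψ hv, h.norm_graph_sub hψ hv hw] at h1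
  set z := fderiv ℝ ψ v u - fderiv ℝ ψ w u with hz
  have h2 : ‖z‖ ≤ κ * ‖v - w‖ ^ α * ‖u‖ :=
    (fderiv ℝ ψ v - fderiv ℝ ψ w).le_of_opNorm_le (hψ.2.2.2 v hv w hw) u
  have h3 : ‖fderiv ℝ g (w, ψ w) (0, z)‖ ≤ (t + ε) * ‖z‖ := by
    have := (fderiv ℝ g (w, ψ w) - T).le_of_opNorm_le
      (h.norm_fderiv_sub_le hg (h.graph_mem hψ hw)) (0, z)
    have e : ‖((0, z) : U × W)‖ = ‖z‖ := by rw [Prod.norm_def]; simp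
    rw [e] at this
    have h4 := norm_sub_norm_le (fderiv ℝ g (w, ψ w) (0, z)) (T (0, z))
    have h5 := hT z
    rw [sub_apply] at this
    nlinarith
  have e : fderiv ℝ g (v, ψ v) (u, fderiv ℝ ψ v u) - fderiv ℝ g (w, ψ w) (u, fderiv ℝ ψ w u) =
      (fderiv ℝ g (v, ψ v) - fderiv ℝ g (w, ψ w)) (u, fderiv ℝ ψ v u) +
        fderiv ℝ g (w, ψ w) (0, z) := by
    have : ((0, z) : U × W) = (u, fderiv ℝ ψ v u) - (u, fderiv ℝ ψ w u) := by simp [hz]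
    rw [this, map_sub, sub_apply]
    abel
  rw [e]
  calc _ ≤ H * ‖v - w‖ ^ α * ‖u‖ + (t + ε) * (κ * ‖v - w‖ ^ α * ‖u‖) :=
        (norm_add_le _ _).trans (add_le_add h1 (h3.trans
          (mul_le_mul_of_nonneg_left h2 (by linarith))))
    _ = _ := by ring

/-- The expansion of tangent vectors makes the derivative of `v ↦ fu (v, ψ v)` injective. As `A` is
bijective the dimensions agree, so this derivative is invertible and the continuous local inverse is
differentiable. -/
lemma exists_hasFDerivAt_pullback [FiniteDimensional ℝ U] [FiniteDimensional ℝ U']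
    {y : U'} (hy : y ∈ ball (0 : U') r') :
    ∃ Q : U' →L[ℝ] U, HasFDerivAt (graphPullback r fu ψ) Q y ∧
      ∀ u, fderiv ℝ fu (graphPullback r fu ψ y, ψ (graphPullback r fu ψ y))
        (Q u, fderiv ℝ ψ (graphPullback r fu ψ y) (Q u)) = u := by
  have : CompleteSpace U := FiniteDimensional.complete ℝ U
  set v := graphPullback r fu ψ y with hv
  have hvm : v ∈ ball (0 : U) r := h.pullback_mem hψ hy
  set D := (fderiv ℝ fu (v, ψ v)).comp ((ContinuousLinearMap.id ℝ U).prod (fderiv ℝ ψ v)) with hD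
  have hc := h.c_pos
  have hDv : ∀ u, D u = fderiv ℝ fu (v, ψ v) (u, fderiv ℝ ψ v u) := fun u => rfl
  have hinj : Function.Injective D.toLinearMap := by
    refine (injective_iff_map_eq_zero _).2 fun u hu => ?_
    have h1 := h.expand_tangent hψ hvm u
    rw [← hDv, show D u = 0 from hu, norm_zero] at h1
    by_contra hne
    have := norm_pos_iff.2 hne
    nlinarith
  have hA : Function.Injective A.toLinearMap := by
    refine (injective_iff_map_eq_zero _).2 fun u hu => ?_
    have h1 := h.expand u
    rw [show A u = 0 from hu, norm_zero] at h1
    by_contra hne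
    have := norm_pos_iff.2 hne
    have := h.ε_pos
    nlinarith
  have hfr : Module.finrank ℝ U = Module.finrank ℝ U' :=
    (LinearEquiv.ofBijective A.toLinearMap ⟨hA, h.surjective⟩).finrank_eq
  let e : U ≃L[ℝ] U' := (LinearMap.linearEquivOfInjective D.toLinearMap hinj hfr).toContinuousLinearEquiv
  have heD : (e : U →L[ℝ] U') = D := by
    ext u
    rfl
  have hcont : ContinuousAt (graphPullback r fu ψ) y :=
    (h.continuousOn_pullback hψ).continuousAt (isOpen_ball.mem_nhds hy)
  refine ⟨(e.symm : U' →L[ℝ] U), ?_, fun u => ?_⟩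
  · refine HasFDerivAt.of_local_left_inverse (f := fun v => fu (v, ψ v)) hcont ?_ ?_
    · rw [heD]
      exact h.hasFDerivAt_comp_graph hψ h.u.differentiableAt hvm
    · filter_upwards [isOpen_ball.mem_nhds hy] with z hz using h.apply_pullback hψ hz
  · rw [← hDv, ← heD]
    exact e.apply_symm_apply u

lemma exists_hasFDerivAt_graphTransform [FiniteDimensional ℝ U] [FiniteDimensional ℝ U']
    {y : U'} (hy : y ∈ ball (0 : U') r') :
    ∃ Q : U' →L[ℝ] U,
      (∀ u, fderiv ℝ fu (graphPullback r fu ψ y, ψ (graphPullback r fu ψ y))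
        (Q u, fderiv ℝ ψ (graphPullback r fu ψ y) (Q u)) = u) ∧
      HasFDerivAt (graphTransform r fu fs ψ)
        (((fderiv ℝ fs (graphPullback r fu ψ y, ψ (graphPullback r fu ψ y))).comp
          ((ContinuousLinearMap.id ℝ U).prod (fderiv ℝ ψ (graphPullback r fu ψ y)))).comp Q) y := by
  have : CompleteSpace U := FiniteDimensional.complete ℝ U
  obtain ⟨Q, hQ, hQ'⟩ := h.exists_hasFDerivAt_pullback hψ hy
  exact ⟨Q, hQ', (h.hasFDerivAt_comp_graph hψ h.s.differentiableAt
    (h.pullback_mem hψ hy)).comp y hQ⟩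

theorem isAdmissible_graphTransform [FiniteDimensional ℝ U] [FiniteDimensional ℝ U'] :
    IsAdmissible α r' κ' (graphTransform r fu fs ψ) := by
  have : CompleteSpace U := FiniteDimensional.complete ℝ U
  have hc := h.c_pos
  have hε := h.ε_pos
  have hγ := h.γ_pos
  have hb := h.b_nonneg
  have hκ := h.κ_pos
  have hdiff : ∀ y ∈ ball (0 : U') r', DifferentiableAt ℝ (graphTransform r fu fs ψ) y :=
    fun y hy => (h.exists_hasFDerivAt_graphTransform hψ hy).choose_spec.2.differentiableAt
  have h0 : (0 : U') ∈ ball (0 : U') r' := mem_ball_self h.r'_pos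
  have hholder : HolderSeminormLE α κ' (fderiv ℝ (graphTransform r fu fs ψ)) (ball 0 r') := by
    intro y hy z hz
    obtain ⟨Q, hQ, hDy⟩ := h.exists_hasFDerivAt_graphTransform hψ hy
    obtain ⟨R, hR, hDz⟩ := h.exists_hasFDerivAt_graphTransform hψ hz
    rw [hDy.fderiv, hDz.fderiv]
    have hv := h.pullback_mem hψ hy
    have hw := h.pullback_mem hψ hz
    have hvw := h.norm_pullback_sub_le hψ hy hz
    set v := graphPullback r fu ψ y
    set w := graphPullback r fu ψ z
    have hpow : ‖v - w‖ ^ α ≤ (a - ε) ^ (-α) * ‖y - z‖ ^ α := by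
      refine (Real.rpow_le_rpow (norm_nonneg _) hvw h.α_pos.le).trans_eq ?_
      rw [Real.mul_rpow (inv_pos.2 hc).le (norm_nonneg _), Real.inv_rpow hc.le,
        Real.rpow_neg hc.le]
    have hyz : 0 ≤ ‖y - z‖ ^ α := Real.rpow_nonneg (norm_nonneg _) _
    have hvw0 : 0 ≤ ‖v - w‖ ^ α := Real.rpow_nonneg (norm_nonneg _) _
    have hpos : 0 < (a - ε) ^ (-1 - α) := Real.rpow_pos_of_pos hc _
    have hb'0 : 0 ≤ b' := le_trans (by positivity) h.b_le
    have hκ'0 : 0 ≤ κ' := le_trans (by positivity) h.κ'_ge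
    refine ContinuousLinearMap.opNorm_le_bound _ (by positivity) fun u => ?_
    have hQu : ‖Q u‖ ≤ ‖u‖ / (a - ε) := by
      have := h.expand_tangent hψ hv (Q u)
      rw [hQ] at this
      rwa [le_div_iff₀ hc, mul_comm]
    have hdiffu := h.norm_tangent_map_sub_le hψ h.u (t := 0) (by simp) le_rfl hv hw (Q u)
    have hdiffs := h.norm_tangent_map_sub_le hψ h.s (t := b)
      (by simpa using h.contract) hb hv hw (Q u)
    -- `Q` and `R` invert the two `u`-derivatives, so applying the one at `w` to `Q u - R u` gives
    -- the difference of the two `u`-derivatives on `Q u`. This bounds `Q - R` without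
    -- differentiating twice.
    have hlin : fderiv ℝ fu (w, ψ w) (Q u - R u, fderiv ℝ ψ w (Q u - R u)) =
        fderiv ℝ fu (w, ψ w) (Q u, fderiv ℝ ψ w (Q u)) -
          fderiv ℝ fu (v, ψ v) (Q u, fderiv ℝ ψ v (Q u)) := by
      rw [hQ, show (Q u - R u, fderiv ℝ ψ w (Q u - R u)) =
        (Q u, fderiv ℝ ψ w (Q u)) - (R u, fderiv ℝ ψ w (R u)) by simp, map_sub, hR]
    have hQR : ‖Q u - R u‖ ≤ (H + ε * κ) * ‖v - w‖ ^ α * ‖Q u‖ / (a - ε) := by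
      rw [le_div_iff₀ hc, mul_comm]
      refine (h.expand_tangent hψ hw (Q u - R u)).trans ?_
      rw [hlin, norm_sub_rev]
      simpa using hdiffu
    have hs := h.norm_s_tangent_le hψ hw (Q u - R u)
    have hfin : ‖fderiv ℝ fs (v, ψ v) (Q u, fderiv ℝ ψ v (Q u)) -
        fderiv ℝ fs (w, ψ w) (R u, fderiv ℝ ψ w (R u))‖ ≤
        ((H + (b + ε) * κ) + (b * γ + ε) * (H + ε * κ) / (a - ε)) * ‖v - w‖ ^ α * ‖Q u‖ := by
      have e : fderiv ℝ fs (v, ψ v) (Q u, fderiv ℝ ψ v (Q u)) -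
        fderiv ℝ fs (w, ψ w) (R u, fderiv ℝ ψ w (R u)) =
        (fderiv ℝ fs (v, ψ v) (Q u, fderiv ℝ ψ v (Q u)) -
          fderiv ℝ fs (w, ψ w) (Q u, fderiv ℝ ψ w (Q u))) +
        fderiv ℝ fs (w, ψ w) (Q u - R u, fderiv ℝ ψ w (Q u - R u)) := by
        rw [show (Q u - R u, fderiv ℝ ψ w (Q u - R u)) =
          (Q u, fderiv ℝ ψ w (Q u)) - (R u, fderiv ℝ ψ w (R u)) by simp, map_sub]
        abel
      rw [e]
      refine (norm_add_le _ _).trans ((add_le_add hdiffs (hs.trans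
        (mul_le_mul_of_nonneg_left hQR (by positivity)))).trans_eq ?_)
      ring
    -- Replacing `H` by `ε * κ` makes every term a multiple of `κ`; the resulting factor is the left
    -- side of `b_le`.
    have hcoef : (H + (b + ε) * κ) + (b * γ + ε) * (H + ε * κ) / (a - ε) ≤ b' * κ := by
      have h1 : (H + (b + ε) * κ) + (b * γ + ε) * (H + ε * κ) / (a - ε) ≤
          (ε * κ + (b + ε) * κ) + (b * γ + ε) * (ε * κ + ε * κ) / (a - ε) := by
        have := h.H_le
        gcongr
      refine h1.trans (le_trans (le_of_eq ?_) (mul_le_mul_of_nonneg_right h.b_le hκ.le))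
      ring
    refine hfin.trans ?_
    -- The exponent `-1 - α` combines one factor `(a - ε)⁻¹` from `Q` with `(a - ε) ^ (-α)` from the
    -- distance of the base points.
    calc _ ≤ b' * κ * ((a - ε) ^ (-α) * ‖y - z‖ ^ α) * (‖u‖ / (a - ε)) := by gcongr
      _ = b' * κ * (a - ε) ^ (-1 - α) * ‖y - z‖ ^ α * ‖u‖ := by
        rw [sub_eq_add_neg (-1 : ℝ) α, Real.rpow_add hc, Real.rpow_neg_one]
        ring
      _ ≤ κ' * ‖y - z‖ ^ α * ‖u‖ := by
        have := h.κ'_ge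
        gcongr
  refine ⟨⟨contDiffOn_one_of_holder h.α_pos isOpen_ball hdiff hholder, κ', hholder⟩, ?_, ?_,
    hholder⟩
  · simp only [graphTransform]
    rw [h.pullback_zero hψ, hψ.2.1]
    exact h.s.map_zero
  · obtain ⟨Q, -, hQ⟩ := h.exists_hasFDerivAt_graphTransform hψ h0
    rw [hQ.fderiv, h.pullback_zero hψ, hψ.2.1, hψ.2.2.1,
      show ((0, 0) : U × W) = 0 from rfl, h.s.fderiv_zero]
    ext u
    simp

/-- One step of the graph transform contracts the distance weighted by the norm of the base
point. -/
theorem norm_graphTransform_sub_le [CompleteSpace U] (hφ : IsAdmissible α r κ φ) {D : ℝ}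
    (hD0 : 0 ≤ D) (hD : ∀ v ∈ ball (0 : U) r, ‖ψ v - φ v‖ ≤ D * ‖v‖)
    {y : U'} (hy : y ∈ ball (0 : U') r') :
    ‖graphTransform r fu fs ψ y - graphTransform r fu fs φ y‖ ≤ b' / (a - ε) * D * ‖y‖ := by
  have hc := h.c_pos
  have hε := h.ε_pos
  have hγ := h.γ_pos
  have hb := h.b_nonneg
  have h0 : (0 : U') ∈ ball (0 : U') r' := mem_ball_self h.r'_pos
  have hv := h.pullback_mem hψ hy
  have hw := h.pullback_mem hφ hy
  have hfv := h.apply_pullback hψ hy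
  have hfw := h.apply_pullback hφ hy
  have hvy := h.norm_pullback_sub_le hψ hy h0
  rw [h.pullback_zero hψ, sub_zero, sub_zero] at hvy
  simp only [graphTransform]
  set v := graphPullback r fu ψ y
  set w := graphPullback r fu φ y
  have hu := h.norm_sub_sub_le h.u (h.graph_mem hψ hv) (h.graph_mem hφ hw)
  have hs := h.norm_sub_sub_le h.s (h.graph_mem hψ hv) (h.graph_mem hφ hw)
  rw [hfv, hfw, sub_self, zero_sub, norm_neg] at hu
  simp only [ContinuousLinearMap.comp_apply, ContinuousLinearMap.coe_fst',
    ContinuousLinearMap.coe_snd', Prod.fst_sub, Prod.snd_sub] at hu hs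
  have hψφ : ‖ψ v - φ w‖ ≤ D * ‖v‖ + γ * ‖v - w‖ := by
    have h1 := hφ.norm_sub_le h.α_pos h.κ_pos.le hv hw
    rw [h.κ_mul] at h1
    have := norm_add_le (ψ v - φ v) (φ v - φ w)
    rw [sub_add_sub_cancel] at this
    linarith [hD v hv]
  have hxy : ‖((v, ψ v) : U × W) - (w, φ w)‖ ≤ ‖v - w‖ + D * ‖v‖ := by
    have h1 : 0 ≤ D * ‖v‖ := by positivity
    have h2 : γ * ‖v - w‖ ≤ ‖v - w‖ := mul_le_of_le_one_left (norm_nonneg _) h.γ_le_one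
    rw [Prod.norm_def]
    refine max_le ?_ ?_
    · change ‖v - w‖ ≤ _
      linarith
    · change ‖ψ v - φ w‖ ≤ _
      linarith
  -- Both points have the same image `y` under `fu`, so `A (v - w)` is a pure error term, at most `ε
  -- * (‖v - w‖ + D * ‖v‖)`; the first summand is absorbed by the expansion of `A`.
  have hvw : ‖v - w‖ ≤ ε * (D * ‖v‖) / (a - ε) := by
    rw [le_div_iff₀ hc]
    have := h.expand (v - w)
    nlinarith
  have h3 := norm_sub_norm_le (fs (v, ψ v) - fs (w, φ w)) (B (ψ v - φ w))
  have h4 := h.contract (ψ v - φ w)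
  have h5 : ‖fs (v, ψ v) - fs (w, φ w)‖ ≤
      b * (D * ‖v‖ + γ * ‖v - w‖) + ε * (‖v - w‖ + D * ‖v‖) := by
    have : b * ‖ψ v - φ w‖ ≤ b * (D * ‖v‖ + γ * ‖v - w‖) := by gcongr
    have : ε * ‖((v, ψ v) : U × W) - (w, φ w)‖ ≤ ε * (‖v - w‖ + D * ‖v‖) := by gcongr
    linarith
  have h6 : b * (D * ‖v‖ + γ * ‖v - w‖) + ε * (‖v - w‖ + D * ‖v‖) ≤ b' * (D * ‖v‖) := by
    have h7 : (b * γ + ε) * ‖v - w‖ ≤ (b * γ + ε) * (ε * (D * ‖v‖) / (a - ε)) := by gcongr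
    have h8 := mul_le_mul_of_nonneg_right h.b_le (show 0 ≤ D * ‖v‖ by positivity)
    have h9 : (b + 2 * ε + 2 * ε * (b * γ + ε) / (a - ε)) * (D * ‖v‖) =
      b * (D * ‖v‖) + 2 * ε * (D * ‖v‖) + 2 * ((b * γ + ε) * (ε * (D * ‖v‖) / (a - ε))) := by
      ring
    have h10 : 0 ≤ (b * γ + ε) * (ε * (D * ‖v‖) / (a - ε)) := by positivity
    have h11 : 0 ≤ ε * (D * ‖v‖) := by positivity
    nlinarith
  have hb'0 : 0 ≤ b' := le_trans (by positivity) h.b_le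
  calc _ ≤ b' * (D * ‖v‖) := h5.trans h6
    _ ≤ b' * (D * ((a - ε)⁻¹ * ‖y‖)) := by gcongr
    _ = _ := by ring

end HyperbolicStep

end GraphTransformStep

/-! ### Pliss' lemma. -/

section Pliss

/-- The indices `n ≥ 1` such that the averages of `a` over all intervals `[k, n)` are at least
`χ`. -/
def averageTimes (a : ℕ → ℝ) (χ : ℝ) : Set ℕ :=
  {n | 0 < n ∧ ∀ k < n, χ ≤ 1 / ((n : ℝ) - (k : ℝ)) * ∑ j ∈ Finset.Ico k n, a j}

/-- These times are the positive weak record times of the partial sums of `a j - χ`. -/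
lemma mem_averageTimes_iff {a : ℕ → ℝ} {χ : ℝ} {n : ℕ} :
    n ∈ averageTimes a χ ↔ 0 < n ∧
      ∀ k < n, ∑ j ∈ Finset.range k, (a j - χ) ≤ ∑ j ∈ Finset.range n, (a j - χ) := by
  refine and_congr_right fun _ => forall_congr' fun k => forall_congr' fun hk => ?_
  have hpos : (0 : ℝ) < (n : ℝ) - k := sub_pos.2 (by exact_mod_cast hk)
  have h2 : ∑ j ∈ Finset.Ico k n, (a j - χ) =
      ∑ j ∈ Finset.Ico k n, a j - ((n : ℝ) - k) * χ := by
    rw [Finset.sum_sub_distrib, Finset.sum_const, Nat.card_Ico, nsmul_eq_mul, Nat.cast_sub hk.le]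
  rw [← Finset.sum_range_add_sum_Ico (fun j => a j - χ) hk.le, h2, one_div, inv_mul_eq_div,
    le_div_iff₀ hpos]
  constructor <;> intro h <;> linarith

lemma sum_le_of_mem_averageTimes {a : ℕ → ℝ} {χ : ℝ} {n k : ℕ} (hn : n ∈ averageTimes a χ)
    (hk : k ≤ n) : ((n : ℝ) - k) * χ ≤ ∑ j ∈ Finset.Ico k n, a j := by
  rcases hk.eq_or_lt with rfl | hk
  · simp
  have hpos : (0 : ℝ) < (n : ℝ) - k := sub_pos.2 (by exact_mod_cast hk)
  have := hn.2 k hk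
  rwa [one_div, inv_mul_eq_div, le_div_iff₀ hpos, mul_comm] at this

/-- The running maximum of the partial sums can rise only at a record time, and then by at most `L -
χ`. If `n + 1` is no record, its partial sum is below an earlier one and induction applies. -/
lemma pliss_sum_le {a : ℕ → ℝ} {χ L : ℝ} (ha : ∀ j, a j ≤ L) (hχ : χ ≤ L) (n : ℕ) :
    ∀ k ≤ n, ∑ j ∈ Finset.range k, (a j - χ) ≤
      (L - χ) * ((averageTimes a χ ∩ Iio (n + 1)).ncard : ℝ) := by
  have hfin : ∀ m, (averageTimes a χ ∩ Iio m).Finite := fun m =>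
    (Set.finite_Iio m).subset inter_subset_right
  induction n with
  | zero =>
    intro k hk
    obtain rfl : k = 0 := by omega
    have : 0 ≤ L - χ := by linarith
    simp only [Finset.range_zero, Finset.sum_empty]
    positivity
  | succ n ih =>
    have hmono : ((averageTimes a χ ∩ Iio (n + 1)).ncard : ℝ) ≤
        (averageTimes a χ ∩ Iio (n + 1 + 1)).ncard := by
      exact_mod_cast Set.ncard_le_ncard
        (inter_subset_inter_right _ (Iio_subset_Iio (by omega))) (hfin _)
    have hold : ∀ k ≤ n, ∑ j ∈ Finset.range k, (a j - χ) ≤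
        (L - χ) * ((averageTimes a χ ∩ Iio (n + 1 + 1)).ncard : ℝ) := fun k hk =>
      (ih k hk).trans (mul_le_mul_of_nonneg_left hmono (by linarith))
    intro k hk
    rcases hk.lt_or_eq with hk | rfl
    · exact hold k (by omega)
    by_cases hmem : n + 1 ∈ averageTimes a χ
    · have hins : averageTimes a χ ∩ Iio (n + 1 + 1) =
          insert (n + 1) (averageTimes a χ ∩ Iio (n + 1)) := by
        ext m
        simp only [mem_inter_iff, mem_Iio, mem_insert_iff]
        constructor
        · rintro ⟨h1, h2⟩
          rcases Nat.lt_succ_iff_lt_or_eq.1 h2 with h | h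
          · exact Or.inr ⟨h1, h⟩
          · exact Or.inl h
        · rintro (rfl | ⟨h1, h2⟩)
          · exact ⟨hmem, by omega⟩
          · exact ⟨h1, by omega⟩
      rw [hins, Set.ncard_insert_of_notMem (by simp) (hfin _), Finset.sum_range_succ]
      push_cast
      have := ih n le_rfl
      have := ha n
      nlinarith
    · rw [mem_averageTimes_iff] at hmem
      push Not at hmem
      obtain ⟨k, hk, hlt⟩ := hmem (by omega)
      exact hlt.le.trans (hold k (by omega))

/-- Pliss' lemma, in terms of lower asymptotic averages and densities. -/
theorem pliss {a : ℕ → ℝ} {χ L M : ℝ} (ha : ∀ j, a j ≤ L) (hM : ∀ j, M ≤ a j)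
    (hχ : χ < liminf (fun n : ℕ => 1 / (n : ℝ) * ∑ k ∈ Finset.range n, a k) atTop) :
    χ < L ∧ (liminf (fun n : ℕ => 1 / (n : ℝ) * ∑ k ∈ Finset.range n, a k) atTop - χ) / (L - χ) ≤
      lowerDensity (averageTimes a χ) := by
  set X := liminf (fun n : ℕ => 1 / (n : ℝ) * ∑ k ∈ Finset.range n, a k) atTop with hX
  have hbdd : IsBoundedUnder (· ≥ ·) atTop
      (fun n : ℕ => 1 / (n : ℝ) * ∑ k ∈ Finset.range n, a k) := by
    refine isBoundedUnder_of ⟨min M 0, fun n => ?_⟩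
    rcases Nat.eq_zero_or_pos n with rfl | hn
    · simp
    have hn' : (0 : ℝ) < n := by exact_mod_cast hn
    have : (n : ℝ) * M ≤ ∑ k ∈ Finset.range n, a k := by
      simpa using Finset.card_nsmul_le_sum (Finset.range n) a M (fun j _ => hM j)
    refine (min_le_left _ _).trans ?_
    rw [one_div, inv_mul_eq_div, le_div_iff₀ hn']
    linarith
  have hev : ∀ c < X, ∀ᶠ n : ℕ in atTop, 0 < n ∧ (n : ℝ) * c < ∑ k ∈ Finset.range n, a k := by
    intro c hc
    filter_upwards [eventually_lt_of_lt_liminf hc hbdd, eventually_gt_atTop 0] with n hn hn0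
    have hn' : (0 : ℝ) < n := by exact_mod_cast hn0
    rw [one_div, inv_mul_eq_div, lt_div_iff₀ hn'] at hn
    exact ⟨hn0, by linarith⟩
  have hsumle : ∀ n : ℕ, ∑ k ∈ Finset.range n, a k ≤ n * L := fun n => by
    simpa using Finset.sum_le_card_nsmul (Finset.range n) a L (fun j _ => ha j)
  have hL : χ < L := by
    obtain ⟨n, hn0, hn⟩ := (hev χ hχ).exists
    have hn' : (0 : ℝ) < n := by exact_mod_cast hn0
    have := hsumle n
    by_contra! hc
    nlinarith
  refine ⟨hL, ?_⟩
  have hpos : 0 < L - χ := sub_pos.2 hL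
  refine le_of_forall_lt fun t ht => ?_
  obtain ⟨s, hts, hs⟩ := exists_between ht
  refine hts.trans_le ?_
  rw [lt_div_iff₀ hpos] at hs
  obtain ⟨c, hsc, hcX⟩ := exists_between (show s * (L - χ) + χ < X by linarith)
  have hlim : Tendsto (fun n : ℕ => (L - χ) / (n : ℝ)) atTop (𝓝 0) :=
    tendsto_const_div_atTop_nhds_zero_nat _
  have hcob : IsCoboundedUnder (· ≥ ·) atTop
      (fun N : ℕ => 1 / (N : ℝ) * ((averageTimes a χ ∩ Iio N).ncard : ℝ)) := by
    refine IsBoundedUnder.isCoboundedUnder_ge (isBoundedUnder_of ⟨1, fun N => ?_⟩)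
    rcases Nat.eq_zero_or_pos N with rfl | hN
    · simp
    have hN' : (0 : ℝ) < N := by exact_mod_cast hN
    rw [one_div, inv_mul_eq_div, div_le_one hN']
    have h1 := Set.ncard_le_ncard (inter_subset_right : averageTimes a χ ∩ Iio N ⊆ Iio N)
      (Set.finite_Iio N)
    rw [Set.ncard_eq_toFinset_card' (Iio N)] at h1
    simp at h1
    exact_mod_cast h1
  refine le_liminf_of_le hcob ?_
  filter_upwards [hev c hcX, hlim.eventually (gt_mem_nhds (show 0 < c - (s * (L - χ) + χ) by
    linarith))] with N ⟨hN0, hN⟩ hN1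
  have hN' : (0 : ℝ) < N := by exact_mod_cast hN0
  rw [div_lt_iff₀ hN'] at hN1
  -- The count of times below `N` dominates the partial sum with `N - 1` terms. The missing term is
  -- at most `L`, and the resulting error `(L - χ) / N` tends to zero.
  obtain ⟨m, rfl⟩ : ∃ m, N = m + 1 := ⟨N - 1, by omega⟩
  have h1 := pliss_sum_le ha hL.le m m le_rfl
  have h2 : ∑ j ∈ Finset.range m, (a j - χ) = ∑ j ∈ Finset.range m, a j - m * χ := by
    simp [Finset.sum_sub_distrib]
  rw [Finset.sum_range_succ] at hN
  have h3 := ha m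
  rw [one_div, inv_mul_eq_div, le_div_iff₀ hN']
  push_cast at *
  refine le_of_mul_le_mul_left ?_ hpos
  nlinarith

end Pliss

/-! ### Angles between subspaces and norms of projections. -/

section Angle

variable {E : Type*} [NormedAddCommGroup E] [InnerProductSpace ℝ E]

/-- The left side is the distance from `v` to the line through `w`; the difference of the squares is
the square of `‖w‖ + ‖v‖ * cos t`. -/
lemma norm_mul_sin_angle_le (v w : E) :
    ‖v‖ * Real.sin (InnerProductGeometry.angle v w) ≤ ‖v + w‖ := by
  set t := InnerProductGeometry.angle v w with ht
  have hin : inner ℝ v w = Real.cos t * (‖v‖ * ‖w‖) :=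
    (InnerProductGeometry.cos_angle_mul_norm_mul_norm v w).symm
  have hsq : ‖v + w‖ ^ 2 = ‖v‖ ^ 2 + 2 * inner ℝ v w + ‖w‖ ^ 2 := norm_add_sq_real v w
  refine le_of_sq_le_sq ?_ (norm_nonneg _)
  have hcs := Real.sin_sq_add_cos_sq t
  rw [hsq, hin]
  nlinarith [sq_nonneg (‖w‖ + ‖v‖ * Real.cos t)]

lemma norm_mul_sin_le_norm_add {P Q : Submodule ℝ E} {θ : ℝ} (hθ : 0 < θ)
    (hang : ∀ v ∈ P, ∀ w ∈ Q, v ≠ 0 → w ≠ 0 → θ ≤ InnerProductGeometry.angle v w)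
    {v w : E} (hv : v ∈ P) (hw : w ∈ Q) : ‖v‖ * Real.sin θ ≤ ‖v + w‖ := by
  by_cases hv0 : v = 0
  · simp [hv0]
  by_cases hw0 : w = 0
  · simpa [hw0] using mul_le_of_le_one_right (norm_nonneg v) (Real.sin_le_one θ)
  have h1 := hang v hv w hw hv0 hw0
  -- Applying the bound to `-v` as well confines the angle to `[θ, π - θ]`, where the sine is at
  -- least `sin θ`.
  have h2 := hang (-v) (P.neg_mem hv) w hw (neg_ne_zero.2 hv0) hw0
  rw [InnerProductGeometry.angle_neg_left] at h2
  refine le_trans (mul_le_mul_of_nonneg_left ?_ (norm_nonneg v)) (norm_mul_sin_angle_le v w)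
  set t := InnerProductGeometry.angle v w
  rcases le_total t (Real.pi / 2) with h | h
  · exact Real.sin_le_sin_of_le_of_le_pi_div_two (by linarith [Real.pi_pos]) h h1
  · rw [← Real.sin_pi_sub t]
    exact Real.sin_le_sin_of_le_of_le_pi_div_two (by linarith [Real.pi_pos]) (by linarith) h2

end Angle

/-! ### The maps in the coordinates given by the splittings. -/

namespace MapSequence

variable {d : ℕ} {S : MapSequence d} {α : ℝ}

local notation "𝔼" => EuclideanSpace ℝ (Fin d)

/-- The projection onto `Eu n` along `Es n`. -/
noncomputable def projU (h : S.C2) (n : ℕ) : 𝔼 →L[ℝ] S.Eu n :=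
  LinearMap.toContinuousLinearMap ((S.Eu n).projectionOnto (S.Es n) (h n).1)

/-- The projection onto `Es n` along `Eu n`. -/
noncomputable def projS (h : S.C2) (n : ℕ) : 𝔼 →L[ℝ] S.Es n :=
  LinearMap.toContinuousLinearMap ((S.Es n).projectionOnto (S.Eu n) (h n).1.symm)

variable (S) in
/-- The isomorphism `Eu n × Es n → ℝ^d` given by addition. -/
noncomputable def sumMap (n : ℕ) : S.Eu n × S.Es n →L[ℝ] 𝔼 :=
  (S.Eu n).subtypeL.coprod (S.Es n).subtypeL

@[simp] lemma sumMap_apply (n : ℕ) (x : S.Eu n × S.Es n) :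
    S.sumMap n x = (x.1 : 𝔼) + (x.2 : 𝔼) := rfl

variable (h2 : S.C2)

@[simp] lemma projU_sumMap (n : ℕ) (x : S.Eu n × S.Es n) : projU h2 n (S.sumMap n x) = x.1 := by
  change (S.Eu n).projectionOnto (S.Es n) (h2 n).1 ((x.1 : 𝔼) + x.2) = x.1
  simp [map_add]

@[simp] lemma projS_sumMap (n : ℕ) (x : S.Eu n × S.Es n) : projS h2 n (S.sumMap n x) = x.2 := by
  change (S.Es n).projectionOnto (S.Eu n) (h2 n).1.symm ((x.1 : 𝔼) + x.2) = x.2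
  simp [map_add]

lemma sumMap_proj (n : ℕ) (z : 𝔼) : S.sumMap n (projU h2 n z, projS h2 n z) = z := by
  have hz : z ∈ S.Eu n ⊔ S.Es n := by rw [(h2 n).1.sup_eq_top]; trivial
  obtain ⟨v, hv, w, hw, rfl⟩ := Submodule.mem_sup.1 hz
  have := projU_sumMap h2 n (⟨v, hv⟩, ⟨w, hw⟩)
  have h' := projS_sumMap h2 n (⟨v, hv⟩, ⟨w, hw⟩)
  simp only [sumMap_apply] at this h'
  rw [this, h']
  rfl

lemma projU_of_mem {n : ℕ} {v : 𝔼} (hv : v ∈ S.Eu n) : projU h2 n v = ⟨v, hv⟩ := by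
  simpa using projU_sumMap h2 n (⟨v, hv⟩, 0)

lemma projS_of_mem {n : ℕ} {w : 𝔼} (hw : w ∈ S.Es n) : projS h2 n w = ⟨w, hw⟩ := by
  simpa using projS_sumMap h2 n (0, ⟨w, hw⟩)

lemma projU_of_mem_Es {n : ℕ} {w : 𝔼} (hw : w ∈ S.Es n) : projU h2 n w = 0 := by
  simpa using projU_sumMap h2 n (0, ⟨w, hw⟩)

lemma projS_of_mem_Eu {n : ℕ} {v : 𝔼} (hv : v ∈ S.Eu n) : projS h2 n v = 0 := by
  simpa using projS_sumMap h2 n (⟨v, hv⟩, 0)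

lemma norm_sumMap_le (n : ℕ) (x : S.Eu n × S.Es n) : ‖S.sumMap n x‖ ≤ 2 * ‖x‖ := by
  have h1 := norm_fst_le x
  have h2 := norm_snd_le x
  have h3 := norm_add_le (x.1 : 𝔼) (x.2 : 𝔼)
  simp only [Submodule.coe_norm] at h1 h2
  rw [sumMap_apply]
  linarith

lemma norm_projU_mul_sin_le (h3 : S.C3 α) (n : ℕ) (z : 𝔼) :
    ‖projU h2 n z‖ * Real.sin (S.θ n) ≤ ‖z‖ := by
  have := norm_mul_sin_le_norm_add (h3 n).1 (h3 n).2.2.2.2.1 (projU h2 n z).2 (projS h2 n z).2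
  have e := sumMap_proj h2 n z
  rw [sumMap_apply] at e
  rwa [e] at this

lemma norm_projS_mul_sin_le (h3 : S.C3 α) (n : ℕ) (z : 𝔼) :
    ‖projS h2 n z‖ * Real.sin (S.θ n) ≤ ‖z‖ := by
  have := norm_mul_sin_le_norm_add (h3 n).1
    (fun v hv w hw hv0 hw0 => by
      rw [InnerProductGeometry.angle_comm]
      exact (h3 n).2.2.2.2.1 w hw v hv hw0 hv0) (projS h2 n z).2 (projU h2 n z).2
  have e := sumMap_proj h2 n z
  rw [sumMap_apply, add_comm] at e
  rwa [e] at this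

lemma sumMap_image (n : ℕ) (r ρ : ℝ) :
    S.sumMap n '' (ball 0 r ×ˢ ball 0 ρ) = S.box n r ρ := by
  ext x
  constructor
  · rintro ⟨y, ⟨hu, hs⟩, rfl⟩
    exact ⟨y.1, y.1.2, y.2, y.2.2, by simpa using hu, by simpa using hs, rfl⟩
  · rintro ⟨v, hv, w, hw, hvr, hwr, rfl⟩
    exact ⟨(⟨v, hv⟩, ⟨w, hw⟩), ⟨by simpa using hvr, by simpa using hwr⟩, rfl⟩

lemma mem_cylinder_iff {n : ℕ} {r : ℝ} {z : 𝔼} :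
    z ∈ S.cylinder n r ↔ ‖projU h2 n z‖ < r := by
  constructor
  · rintro ⟨v, hv, w, hw, hr, rfl⟩
    have := projU_sumMap h2 n (⟨v, hv⟩, ⟨w, hw⟩)
    simp only [sumMap_apply] at this
    rw [this]
    exact hr
  · intro h
    exact ⟨projU h2 n z, (projU h2 n z).2, projS h2 n z, (projS h2 n z).2, h,
      (sumMap_proj h2 n z).symm⟩

include h2 in
lemma isOpen_cylinder (n : ℕ) (r : ℝ) : IsOpen (S.cylinder n r) := by
  have : S.cylinder n r = {z | ‖projU h2 n z‖ < r} := by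
    ext z
    exact mem_cylinder_iff h2
  rw [this]
  exact isOpen_lt (projU h2 n).continuous.norm continuous_const

/-- The `u`-component of `f n` in the coordinates given by the splittings. -/
noncomputable def coordU (h : S.C2) (n : ℕ) (x : S.Eu n × S.Es n) : S.Eu (n + 1) :=
  projU h (n + 1) (S.f n (S.sumMap n x))

/-- The `s`-component of `f n` in the coordinates given by the splittings. -/
noncomputable def coordS (h : S.C2) (n : ℕ) (x : S.Eu n × S.Es n) : S.Es (n + 1) :=
  projS h (n + 1) (S.f n (S.sumMap n x))

/-- The restriction of `D(f n)(0)` to `Eu n`. -/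
noncomputable def linU (h : S.C2) (n : ℕ) : S.Eu n →L[ℝ] S.Eu (n + 1) :=
  ((projU h (n + 1)).comp (fderiv ℝ (S.f n) 0)).comp (S.Eu n).subtypeL

/-- The restriction of `D(f n)(0)` to `Es n`. -/
noncomputable def linS (h : S.C2) (n : ℕ) : S.Es n →L[ℝ] S.Es (n + 1) :=
  ((projS h (n + 1)).comp (fderiv ℝ (S.f n) 0)).comp (S.Es n).subtypeL

lemma sumMap_coord (n : ℕ) (x : S.Eu n × S.Es n) :
    S.sumMap (n + 1) (coordU h2 n x, coordS h2 n x) = S.f n (S.sumMap n x) :=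
  sumMap_proj h2 (n + 1) _

include h2 in
lemma fderiv_mem_Eu (n : ℕ) {v : 𝔼} (hv : v ∈ S.Eu n) :
    fderiv ℝ (S.f n) 0 v ∈ S.Eu (n + 1) := by
  rw [← (h2 n).2.1]
  exact Submodule.mem_map_of_mem hv

include h2 in
lemma fderiv_mem_Es (n : ℕ) {w : 𝔼} (hw : w ∈ S.Es n) :
    fderiv ℝ (S.f n) 0 w ∈ S.Es (n + 1) := by
  rw [← (h2 n).2.2]
  exact Submodule.mem_map_of_mem hw

lemma coe_linU (n : ℕ) (v : S.Eu n) : (linU h2 n v : 𝔼) = fderiv ℝ (S.f n) 0 v := by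
  have := projU_of_mem h2 (fderiv_mem_Eu h2 n v.2)
  exact congrArg Subtype.val this

lemma coe_linS (n : ℕ) (w : S.Es n) : (linS h2 n w : 𝔼) = fderiv ℝ (S.f n) 0 w := by
  have := projS_of_mem h2 (fderiv_mem_Es h2 n w.2)
  exact congrArg Subtype.val this

lemma linU_surjective (n : ℕ) : Function.Surjective (linU h2 n) := by
  rintro ⟨y, hy⟩
  rw [← (h2 n).2.1] at hy
  obtain ⟨v, hv, rfl⟩ := hy
  exact ⟨⟨v, hv⟩, Subtype.ext (coe_linU h2 n ⟨v, hv⟩)⟩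

lemma norm_linU_ge (h3 : S.C3 α) (n : ℕ) (v : S.Eu n) :
    Real.exp (S.lu n) * ‖v‖ ≤ ‖linU h2 n v‖ := by
  rw [Submodule.coe_norm, Submodule.coe_norm, coe_linU]
  exact (h3 n).2.2.1 v v.2

lemma norm_linS_le (h3 : S.C3 α) (n : ℕ) (w : S.Es n) :
    ‖linS h2 n w‖ ≤ Real.exp (S.ls n) * ‖w‖ := by
  rw [Submodule.coe_norm, Submodule.coe_norm, coe_linS]
  exact (h3 n).2.2.2.1 w w.2

lemma sin_pos (h3 : S.C3 α) (n : ℕ) : 0 < Real.sin (S.θ (n + 1)) := by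
  have h1 := (h3 n).2.1
  have h4 := (h3 n).2.2.2.2.2.1
  by_contra! hc
  nlinarith

/-- The factor `sin (θ (n + 1))` in (C3) cancels the norm of the projection. The constant `4` bounds
`2 ^ α * 2`: `sumMap` has norm at most `2` and acts once on the difference of base points and once
on the tangent vector. -/
lemma hasHolderDeriv_comp (h1 : S.C1 α) (h3 : S.C3 α) (hα0 : 0 < α) (hα1 : α ≤ 1) (n : ℕ)
    {V : Type*} [NormedAddCommGroup V] [NormedSpace ℝ V] (P : 𝔼 →L[ℝ] V)
    (hP : ∀ z, ‖P z‖ * Real.sin (S.θ (n + 1)) ≤ ‖z‖) {K : Set (S.Eu n × S.Es n)}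
    (hK : ∀ x ∈ K, S.sumMap n x ∈ S.Ω n) {T : S.Eu n × S.Es n →L[ℝ] V}
    (hT : ∀ x, P (fderiv ℝ (S.f n) 0 (S.sumMap n x)) = T x) :
    HasHolderDeriv α (4 * S.β n) T (fun x => P (S.f n (S.sumMap n x))) K := by
  obtain ⟨hopen, hzero, hC, -, -, hf0⟩ := h1 n
  have hsin := sin_pos h3 n
  have hβ := (h3 n).2.1
  have hdf : ∀ z ∈ S.Ω n, DifferentiableAt ℝ (S.f n) z := fun z hz =>
    (hC.1.differentiableOn (by simp)).differentiableAt (hopen.mem_nhds hz)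
  have hd : ∀ x, S.sumMap n x ∈ S.Ω n → HasFDerivAt (fun x => P (S.f n (S.sumMap n x)))
      (P.comp ((fderiv ℝ (S.f n) (S.sumMap n x)).comp (S.sumMap n))) x := fun x hx =>
    P.hasFDerivAt.comp x ((hdf _ hx).hasFDerivAt.comp x (S.sumMap n).hasFDerivAt)
  refine ⟨fun x hx => (hd x (hK x hx)).differentiableAt, ?_, ?_, ?_⟩
  · have h0 : S.sumMap n 0 = 0 := map_zero _
    rw [(hd 0 (by rwa [h0])).fderiv, h0]
    ext x
    · exact hT _
    · exact hT _
  · change P (S.f n (S.sumMap n 0)) = 0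
    rw [map_zero, hf0, map_zero]
  · intro x hx y hy
    rw [(hd x (hK x hx)).fderiv, (hd y (hK y hy)).fderiv]
    refine ContinuousLinearMap.opNorm_le_bound _ (by positivity) fun u => ?_
    have hH := (h3 n).2.2.2.2.2.2 _ (hK x hx) _ (hK y hy)
    set D := fderiv ℝ (S.f n) (S.sumMap n x) - fderiv ℝ (S.f n) (S.sumMap n y) with hD
    have e : (P.comp ((fderiv ℝ (S.f n) (S.sumMap n x)).comp (S.sumMap n)) -
        P.comp ((fderiv ℝ (S.f n) (S.sumMap n y)).comp (S.sumMap n))) u =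
        P (D (S.sumMap n u)) := by
      simp [hD]
    rw [e]
    have h4 : ‖D (S.sumMap n u)‖ ≤ S.β n * Real.sin (S.θ (n + 1)) *
        ‖S.sumMap n x - S.sumMap n y‖ ^ α * ‖S.sumMap n u‖ := D.le_of_opNorm_le hH _
    have h5 : ‖S.sumMap n x - S.sumMap n y‖ ^ α ≤ 2 * ‖x - y‖ ^ α := by
      rw [← map_sub]
      refine (Real.rpow_le_rpow (norm_nonneg _) (norm_sumMap_le n _) hα0.le).trans ?_
      rw [Real.mul_rpow (by norm_num) (norm_nonneg _)]
      refine mul_le_mul_of_nonneg_right ?_ (Real.rpow_nonneg (norm_nonneg _) _)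
      exact (Real.rpow_le_rpow_of_exponent_le (by norm_num) hα1).trans_eq (Real.rpow_one 2)
    have h6 := norm_sumMap_le n u
    have h7 : ‖D (S.sumMap n u)‖ ≤ S.β n * Real.sin (S.θ (n + 1)) *
        (2 * ‖x - y‖ ^ α) * (2 * ‖u‖) := h4.trans (by gcongr)
    have h8 := (hP (D (S.sumMap n u))).trans h7
    refine le_of_mul_le_mul_right (h8.trans_eq ?_) hsin
    ring

/-- The coordinate form of `f n` satisfies the hypotheses of the graph transform as soon as the
radius is small compared with `β n`, and `κ` is large compared with `β n`. -/
theorem hyperbolicStep {L : ℝ} (h1 : S.C1 α) (h3 : S.C3 α) (h4 : S.C4 L) (hα0 : 0 < α)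
    (hα1 : α ≤ 1) {n : ℕ} {ε η r κ γ r' κ' : ℝ} (hη : 0 < η) (hε : 0 < ε)
    (hε1 : ε ≤ Real.exp (-L) * (1 - Real.exp (-η)))
    (hε2 : 2 * ε + 2 * ε * (Real.exp L * γ + ε) * Real.exp (L + η) ≤
      Real.exp (-L) * (Real.exp η - 1))
    (hr : 0 < r) (hκ : 0 < κ) (hr' : 0 < r') (hγ : κ * r ^ α = γ) (hγ1 : γ ≤ 1)
    (hbox : S.box n r (γ * r) ⊆ S.Ω n)
    (hβr : 4 * S.β n * r ^ α ≤ ε) (hβκ : 4 * S.β n ≤ ε * κ)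
    (hr'r : r' ≤ Real.exp (S.lu n - η) * r)
    (hκ' : κ * Real.exp (S.ls n + η - (1 + α) * (S.lu n - η)) ≤ κ') :
    HyperbolicStep α (4 * S.β n) ε (Real.exp (S.lu n)) (Real.exp (S.ls n))
      (Real.exp (S.ls n + η)) r κ γ r' κ' (linU h2 n) (linS h2 n) (coordU h2 n)
      (coordS h2 n) ∧ Real.exp (S.lu n - η) ≤ Real.exp (S.lu n) - ε := by
  have hβ := (h3 n).2.1
  have hγ0 : 0 < γ := by rw [← hγ]; positivity
  obtain ⟨hlu, hls, -⟩ := h4 n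
  rw [abs_le] at hlu hls
  have hK : ∀ x ∈ ball (0 : S.Eu n) r ×ˢ ball (0 : S.Es n) (γ * r), S.sumMap n x ∈ S.Ω n :=
    fun x hx => hbox (by rw [← sumMap_image]; exact mem_image_of_mem _ hx)
  have hη1 : Real.exp (-η) < 1 := by simpa using hη
  have hc : Real.exp (S.lu n - η) ≤ Real.exp (S.lu n) - ε := by
    have e1 : Real.exp (S.lu n - η) = Real.exp (S.lu n) * Real.exp (-η) := by
      rw [← Real.exp_add, sub_eq_add_neg]
    have e2 : Real.exp (-L) ≤ Real.exp (S.lu n) := Real.exp_le_exp.2 hlu.1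
    rw [e1]
    nlinarith
  have hcpos : 0 < Real.exp (S.lu n) - ε := (Real.exp_pos _).trans_le hc
  refine ⟨⟨?_, ?_, norm_linU_ge h2 h3 n, norm_linS_le h2 h3 n, linU_surjective h2 n, hα0,
    by positivity, hε, by linarith, (Real.exp_pos _).le, hr, hκ, hr', hγ, hγ1, hβr, hβκ, ?_, ?_,
    ?_⟩, hc⟩
  · refine hasHolderDeriv_comp h1 h3 hα0 hα1 n _ (norm_projU_mul_sin_le h2 h3 _) hK fun x => ?_
    rw [sumMap_apply, map_add, map_add, projU_of_mem_Es h2 (fderiv_mem_Es h2 n x.2.2), add_zero]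
    rfl
  · refine hasHolderDeriv_comp h1 h3 hα0 hα1 n _ (norm_projS_mul_sin_le h2 h3 _) hK fun x => ?_
    rw [sumMap_apply, map_add, map_add, projS_of_mem_Eu h2 (fderiv_mem_Eu h2 n x.1.2), zero_add]
    rfl
  · exact hr'r.trans (mul_le_mul_of_nonneg_right hc hr.le)
  · have e1 : (Real.exp (S.lu n) - ε)⁻¹ ≤ Real.exp (L + η) := by
      rw [inv_le_comm₀ hcpos (Real.exp_pos _), ← Real.exp_neg]
      exact (Real.exp_le_exp.2 (by linarith)).trans hc
    have e2 : Real.exp (S.ls n) ≤ Real.exp L := Real.exp_le_exp.2 hls.2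
    have e3 : Real.exp (-L) ≤ Real.exp (S.ls n) := Real.exp_le_exp.2 hls.1
    have e4 : 2 * ε * (Real.exp (S.ls n) * γ + ε) / (Real.exp (S.lu n) - ε) ≤
        2 * ε * (Real.exp L * γ + ε) * Real.exp (L + η) := by
      rw [div_eq_mul_inv]
      gcongr
    have e5 : 0 < Real.exp η - 1 := by linarith [Real.one_lt_exp_iff.2 hη]
    rw [Real.exp_add]
    nlinarith
  · refine le_trans ?_ hκ'
    have e1 : (Real.exp (S.lu n) - ε) ^ (-1 - α) ≤ Real.exp (S.lu n - η) ^ (-1 - α) :=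
      Real.rpow_le_rpow_of_nonpos (Real.exp_pos _) hc (by linarith)
    rw [← Real.exp_mul] at e1
    calc _ ≤ Real.exp (S.ls n + η) * κ * Real.exp ((S.lu n - η) * (-1 - α)) := by gcongr
      _ = κ * (Real.exp (S.ls n + η) * Real.exp ((S.lu n - η) * (-1 - α))) := by ring
      _ = _ := by
        rw [← Real.exp_add]
        ring_nf

end MapSequence

/-! ### Graph transforms along the whole sequence. -/

namespace MapSequence

variable {d : ℕ} {S : MapSequence d} {α : ℝ}

local notation "𝔼" => EuclideanSpace ℝ (Fin d)

/-- All the maps `f n`, in the coordinates given by the splittings, satisfy the hypotheses of the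
graph transform for the parameters `r n`, `κ n`. -/
structure AdmissibleRadii (h2 : S.C2) (α ε η γ : ℝ) (r κ : ℕ → ℝ) : Prop where
  step : ∀ n, HyperbolicStep α (4 * S.β n) ε (Real.exp (S.lu n)) (Real.exp (S.ls n))
    (Real.exp (S.ls n + η)) (r n) (κ n) γ (r (n + 1)) (κ (n + 1)) (linU h2 n) (linS h2 n)
    (coordU h2 n) (coordS h2 n)
  rate_le : ∀ n, Real.exp (S.lu n - η) ≤ Real.exp (S.lu n) - ε

lemma mem_graph_iff {n : ℕ} {r : ℝ} {ψ : S.Eu n → S.Es n} {x : 𝔼} :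
    x ∈ S.graph n r ψ ↔ ∃ v ∈ ball (0 : S.Eu n) r, x = S.sumMap n (v, ψ v) := by
  simp [graph]

lemma mem_graph_iff_proj (h2 : S.C2) {n : ℕ} {r : ℝ} {ψ : S.Eu n → S.Es n} {x : 𝔼} :
    x ∈ S.graph n r ψ ↔ projU h2 n x ∈ ball (0 : S.Eu n) r ∧
      projS h2 n x = ψ (projU h2 n x) := by
  rw [mem_graph_iff]
  constructor
  · rintro ⟨v, hv, rfl⟩
    rw [projU_sumMap, projS_sumMap]
    exact ⟨hv, rfl⟩
  · rintro ⟨h, h'⟩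
    exact ⟨_, h, by rw [← h', sumMap_proj]⟩

lemma F_self (m : ℕ) (x : 𝔼) : S.F m m x = x := by
  simp [F, compFrom]

lemma F_succ {m k : ℕ} (h : m ≤ k) (x : 𝔼) : S.F m (k + 1) x = S.f k (S.F m k x) := by
  obtain ⟨j, rfl⟩ := Nat.exists_eq_add_of_le h
  simp only [F, Nat.add_sub_cancel_left, show m + j + 1 - m = j + 1 by omega]
  rfl

namespace AdmissibleRadii

variable {h2 : S.C2} {ε η γ : ℝ} {r κ : ℕ → ℝ} (H : AdmissibleRadii h2 α ε η γ r κ)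

include H

/-- The image of the graph is itself a graph over its `u`-projection, which covers the ball of
radius `r (n + 1)`. The open cylinder over this ball serves as the open set in `IsGraphTransform`.
-/
lemma graph_graphTransform (n : ℕ) {ψ : S.Eu n → S.Es n} (hψ : S.CHat α n (r n) (κ n) ψ) :
    S.graph (n + 1) (r (n + 1)) (graphTransform (r n) (coordU h2 n) (coordS h2 n) ψ) =
      S.f n '' S.graph n (r n) ψ ∩ S.cylinder (n + 1) (r (n + 1)) := by
  have hst := H.step n
  ext y
  constructor
  · rw [mem_graph_iff]
    rintro ⟨v, hv, rfl⟩
    refine ⟨⟨_, mem_graph_iff.2 ⟨_, hst.pullback_mem hψ hv, rfl⟩, ?_⟩, ?_⟩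
    · rw [← sumMap_coord h2, hst.apply_pullback hψ hv]
      rfl
    · rw [mem_cylinder_iff h2, projU_sumMap]
      simpa using hv
  · rintro ⟨⟨x, hx, rfl⟩, hy⟩
    obtain ⟨v, hv, rfl⟩ := mem_graph_iff.1 hx
    rw [mem_cylinder_iff h2] at hy
    refine mem_graph_iff.2 ⟨coordU h2 n (v, ψ v), mem_ball_zero_iff.2 hy, ?_⟩
    rw [← sumMap_coord h2, graphTransform, hst.pullback_apply hψ hv]

lemma isGraphTransform (n : ℕ) {ψ : S.Eu n → S.Es n} (hψ : S.CHat α n (r n) (κ n) ψ) :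
    S.IsGraphTransform α r κ n ψ (graphTransform (r n) (coordU h2 n) (coordS h2 n) ψ) :=
  ⟨(H.step n).isAdmissible_graphTransform hψ, _, isOpen_cylinder h2 _ _,
    H.graph_graphTransform n hψ⟩

/-- A competing graph lies in the image and over the ball, hence in the graph of `graphTransform`;
both are graphs over the same ball. -/
lemma eqOn_graphTransform (n : ℕ) {ψ : S.Eu n → S.Es n} (hψ : S.CHat α n (r n) (κ n) ψ)
    {ψ' : S.Eu (n + 1) → S.Es (n + 1)} (h : S.IsGraphTransform α r κ n ψ ψ') :
    EqOn (graphTransform (r n) (coordU h2 n) (coordS h2 n) ψ) ψ' (ball 0 (r (n + 1))) := by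
  obtain ⟨-, U, -, hU⟩ := h
  intro v hv
  have hmem : S.sumMap (n + 1) (v, ψ' v) ∈ S.graph (n + 1) (r (n + 1)) ψ' :=
    mem_graph_iff.2 ⟨v, hv, rfl⟩
  rw [hU] at hmem
  have : S.sumMap (n + 1) (v, ψ' v) ∈
      S.graph (n + 1) (r (n + 1)) (graphTransform (r n) (coordU h2 n) (coordS h2 n) ψ) := by
    rw [H.graph_graphTransform n hψ]
    refine ⟨hmem.1, ?_⟩
    rw [mem_cylinder_iff h2, projU_sumMap]
    simpa using hv
  rw [mem_graph_iff_proj h2, projU_sumMap, projS_sumMap] at this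
  exact this.2.symm

theorem graphTransformDefined (n : ℕ) : S.GraphTransformDefined α r κ n :=
  fun _ hψ => ⟨_, H.isGraphTransform n hψ, fun _ h => H.eqOn_graphTransform n hψ h⟩

lemma graph_eq (n : ℕ) {ψ : S.Eu n → S.Es n} (hψ : S.CHat α n (r n) (κ n) ψ)
    {ψ' : S.Eu (n + 1) → S.Es (n + 1)} (h : S.IsGraphTransform α r κ n ψ ψ') :
    S.graph (n + 1) (r (n + 1)) ψ' =
      S.f n '' S.graph n (r n) ψ ∩ S.cylinder (n + 1) (r (n + 1)) := by
  rw [← H.graph_graphTransform n hψ]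
  ext x
  rw [mem_graph_iff_proj h2, mem_graph_iff_proj h2]
  refine and_congr_right fun hx => ?_
  rw [H.eqOn_graphTransform n hψ h hx]

lemma graph_subset_box (n : ℕ) {ψ : S.Eu n → S.Es n} (hψ : S.CHat α n (r n) (κ n) ψ) :
    S.graph n (r n) ψ ⊆ S.box n (r n) (κ n * r n ^ α * r n) := by
  intro x hx
  obtain ⟨v, hv, rfl⟩ := mem_graph_iff.1 hx
  rw [← sumMap_image, (H.step n).κ_mul]
  exact mem_image_of_mem _ ((H.step n).graph_mem hψ hv)

variable {ψ φ : ∀ n, S.Eu n → S.Es n} (hψ : S.IsGraphTransformOrbit α r κ ψ)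

omit H in
include hψ in
lemma _root_.MapSequence.IsGraphTransformOrbit.cHat (n : ℕ) : S.CHat α n (r n) (κ n) (ψ n) := by
  cases n with
  | zero => exact hψ.1
  | succ n => exact (hψ.2 n).1

include hψ

/-- As long as the orbit stays in the boxes, its `u`-coordinate stays in the cylinders, where the
image of a graph is exactly the next graph. Time `n` is excluded, since the domain puts no condition
there. -/
lemma F_mem_graph {m n : ℕ} {x : 𝔼}
    (hx : x ∈ S.graph m (r m) (ψ m) ∩
      S.orbitDomain (fun k => S.box k (r k) (κ k * r k ^ α * r k)) m n)
    {k : ℕ} (hmk : m ≤ k) (hkn : k < n) : S.F m k x ∈ S.graph k (r k) (ψ k) := by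
  have hdom := connectedComponentIn_subset _ _ hx.2
  induction k, hmk using Nat.le_induction with
  | base => rw [F_self]; exact hx.1
  | succ k hmk ih =>
    rw [H.graph_eq k (hψ.cHat k) (hψ.2 k), F_succ hmk]
    refine ⟨mem_image_of_mem _ (ih (by omega)), ?_⟩
    obtain ⟨v, hv, w, hw, hvr, -, e⟩ := hdom (k + 1) (by omega) hkn
    rw [F_succ hmk] at e
    exact ⟨v, hv, w, hw, hvr, e⟩

/-- The inverse branch of `F 0 n` along the graphs is continuous on the ball of radius `r n`. -/
lemma exists_section (n : ℕ) : ∃ σ : S.Eu n → 𝔼, ContinuousOn σ (ball 0 (r n)) ∧ σ 0 = 0 ∧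
    ∀ v ∈ ball (0 : S.Eu n) (r n), (∀ k ≤ n, S.F 0 k (σ v) ∈ S.graph k (r k) (ψ k)) ∧
      S.F 0 n (σ v) = S.sumMap n (v, ψ n v) := by
  induction n with
  | zero =>
    refine ⟨fun v => S.sumMap 0 (v, ψ 0 v), ?_, ?_, fun v hv => ⟨fun k hk => ?_, F_self 0 _⟩⟩
    · exact (S.sumMap 0).continuous.comp_continuousOn
        (continuousOn_id.prodMk (hψ.cHat 0).1.1.continuousOn)
    · change S.sumMap 0 (0, ψ 0 0) = 0
      rw [(hψ.cHat 0).2.1]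
      exact map_zero _
    · obtain rfl : k = 0 := by omega
      rw [F_self]
      exact mem_graph_iff.2 ⟨v, hv, rfl⟩
  | succ n ih =>
    obtain ⟨σ, hσc, hσ0, hσ⟩ := ih
    have hst := H.step n
    have hn := hψ.cHat n
    have hlast : ∀ v ∈ ball (0 : S.Eu (n + 1)) (r (n + 1)),
        S.F 0 (n + 1) (σ (graphPullback (r n) (coordU h2 n) (ψ n) v)) =
          S.sumMap (n + 1) (v, ψ (n + 1) v) := by
      intro v hv
      rw [F_succ (Nat.zero_le n), (hσ _ (hst.pullback_mem hn hv)).2, ← sumMap_coord h2,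
        hst.apply_pullback hn hv, ← H.eqOn_graphTransform n hn (hψ.2 n) hv]
      rfl
    refine ⟨fun v => σ (graphPullback (r n) (coordU h2 n) (ψ n) v), ?_, ?_, fun v hv =>
      ⟨fun k hk => ?_, hlast v hv⟩⟩
    · exact hσc.comp (hst.continuousOn_pullback hn) fun v hv => hst.pullback_mem hn hv
    · change σ (graphPullback (r n) (coordU h2 n) (ψ n) 0) = 0
      rw [hst.pullback_zero hn, hσ0]
    · rcases hk.lt_or_eq with hk | rfl
      · exact (hσ _ (hst.pullback_mem hn hv)).1 k (by omega)
      · rw [hlast v hv]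
        exact mem_graph_iff.2 ⟨v, hv, rfl⟩

theorem graph_eq_image {n : ℕ} (hn : 0 < n) :
    S.graph n (r n) (ψ n) =
      S.F 0 n '' (S.graph 0 (r 0) (ψ 0) ∩
        S.orbitDomain (fun k => S.box k (r k) (κ k * r k ^ α * r k)) 0 n) ∩
      S.cylinder n (r n) := by
  ext y
  constructor
  · intro hy
    obtain ⟨v, hv, rfl⟩ := mem_graph_iff.1 hy
    obtain ⟨σ, hσc, hσ0, hσ⟩ := H.exists_section hψ n
    refine ⟨⟨σ v, ⟨?_, ?_⟩, (hσ v hv).2⟩, ?_⟩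
    · have := (hσ v hv).1 0 (Nat.zero_le n)
      rwa [F_self] at this
    -- The continuous inverse branch carries the ball to a connected set through `0` whose orbit
    -- stays in the boxes, so it lies in the component of `0`.
    · have hpre : IsPreconnected (σ '' ball (0 : S.Eu n) (r n)) :=
        (convex_ball _ _).isPreconnected.image σ hσc
      refine hpre.subset_connectedComponentIn ⟨0, mem_ball_self (H.step n).r_pos, hσ0⟩ ?_
        (mem_image_of_mem σ hv)
      rintro _ ⟨w, hw, rfl⟩ k - hk
      exact H.graph_subset_box k (hψ.cHat k) ((hσ w hw).1 k hk.le)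
    · rw [mem_cylinder_iff h2, projU_sumMap]
      simpa using hv
  · rintro ⟨⟨x, hx, rfl⟩, hy⟩
    obtain ⟨n, rfl⟩ : ∃ m, n = m + 1 := ⟨n - 1, by omega⟩
    rw [H.graph_eq n (hψ.cHat n) (hψ.2 n)]
    refine ⟨?_, hy⟩
    rw [F_succ (Nat.zero_le n)]
    exact mem_image_of_mem _ (H.F_mem_graph hψ hx (Nat.zero_le n) (by omega))

omit hψ in
lemma expand_projU {n : ℕ} {ψ : S.Eu n → S.Es n} (hψ : S.CHat α n (r n) (κ n) ψ) {x y : 𝔼}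
    (hx : x ∈ S.graph n (r n) ψ) (hy : y ∈ S.graph n (r n) ψ) :
    (Real.exp (S.lu n) - ε) * ‖projU h2 n (x - y)‖ ≤
      ‖projU h2 (n + 1) (S.f n x - S.f n y)‖ := by
  obtain ⟨v, hv, rfl⟩ := mem_graph_iff.1 hx
  obtain ⟨w, hw, rfl⟩ := mem_graph_iff.1 hy
  rw [map_sub, map_sub, projU_sumMap, projU_sumMap]
  exact (H.step n).expand_graph hψ hv hw

omit hψ in
lemma norm_projS_le {n : ℕ} {ψ : S.Eu n → S.Es n} (hψ : S.CHat α n (r n) (κ n) ψ) {x y : 𝔼}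
    (hx : x ∈ S.graph n (r n) ψ) (hy : y ∈ S.graph n (r n) ψ) :
    ‖projS h2 (n + 1) (S.f n x - S.f n y)‖ ≤
      (Real.exp (S.ls n) * γ + ε) * ‖projU h2 n (x - y)‖ := by
  obtain ⟨v, hv, rfl⟩ := mem_graph_iff.1 hx
  obtain ⟨w, hw, rfl⟩ := mem_graph_iff.1 hy
  rw [map_sub, map_sub, projU_sumMap, projU_sumMap]
  exact (H.step n).norm_s_sub_le hψ hv hw

omit hψ in
lemma norm_sub_le_projU {n : ℕ} {ψ : S.Eu n → S.Es n} (hψ : S.CHat α n (r n) (κ n) ψ)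
    {x y : 𝔼} (hx : x ∈ S.graph n (r n) ψ) (hy : y ∈ S.graph n (r n) ψ) :
    ‖x - y‖ ≤ (1 + γ) * ‖projU h2 n (x - y)‖ := by
  obtain ⟨v, hv, rfl⟩ := mem_graph_iff.1 hx
  obtain ⟨w, hw, rfl⟩ := mem_graph_iff.1 hy
  rw [map_sub, projU_sumMap, projU_sumMap]
  have h1 := IsAdmissible.norm_sub_le hψ (H.step n).α_pos (H.step n).κ_pos.le hv hw
  rw [(H.step n).κ_mul] at h1
  have e : S.sumMap n (v, ψ v) - S.sumMap n (w, ψ w) =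
      ((v - w : S.Eu n) : 𝔼) + ((ψ v - ψ w : S.Es n) : 𝔼) := by
    simp only [sumMap_apply, Submodule.coe_sub]
    abel
  rw [e, add_mul, one_mul]
  exact (norm_add_le _ _).trans (add_le_add le_rfl h1)

/-- The `u`-coordinate of a difference grows by `exp (lu j - η)` at each step. Passing between this
coordinate and the full norm costs a factor `exp (-η)` at each end. -/
theorem expand_F {L : ℝ} (h4 : S.C4 L) (hγη : γ ≤ η)
    (hcone : (Real.exp L * γ + ε) * Real.exp (L + η) ≤ 1 - Real.exp (-η)) {m n : ℕ}
    (hmn : m < n) {x y : 𝔼}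
    (hx : x ∈ S.graph m (r m) (ψ m) ∩
      S.orbitDomain (fun k => S.box k (r k) (κ k * r k ^ α * r k)) m n)
    (hy : y ∈ S.graph m (r m) (ψ m) ∩
      S.orbitDomain (fun k => S.box k (r k) (κ k * r k ^ α * r k)) m n) :
    Real.exp (∑ j ∈ Finset.Ico m n, (S.lu j - η) - 2 * η) * ‖x - y‖ ≤
      ‖S.F m n x - S.F m n y‖ := by
  have hgrow : ∀ k, m ≤ k → k ≤ n →
      Real.exp (∑ j ∈ Finset.Ico m k, (S.lu j - η)) * ‖projU h2 m (x - y)‖ ≤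
        ‖projU h2 k (S.F m k x - S.F m k y)‖ := by
    intro k hmk
    induction k, hmk using Nat.le_induction with
    | base => simp [F_self]
    | succ k hmk ih =>
      intro hkn
      have h1 := H.expand_projU (hψ.cHat k) (H.F_mem_graph hψ hx hmk hkn)
        (H.F_mem_graph hψ hy hmk hkn)
      rw [F_succ hmk, F_succ hmk]
      refine le_trans ?_ h1
      rw [Finset.sum_Ico_succ_top hmk, Real.exp_add, mul_right_comm, mul_comm]
      exact mul_le_mul (H.rate_le k) (ih (by omega)) (by positivity)
        ((Real.exp_pos _).le.trans (H.rate_le k))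
  have h0 := H.norm_sub_le_projU (hψ.cHat m) hx.1 hy.1
  obtain ⟨n, rfl⟩ : ∃ p, n = p + 1 := ⟨n - 1, by omega⟩
  have hmn' : m ≤ n := by omega
  have hlast := hgrow (n + 1) (by omega) le_rfl
  have hxn := H.F_mem_graph hψ hx hmn' (Nat.lt_succ_self n)
  have hyn := H.F_mem_graph hψ hy hmn' (Nat.lt_succ_self n)
  have hu := H.expand_projU (hψ.cHat n) hxn hyn
  have hs := H.norm_projS_le (hψ.cHat n) hxn hyn
  rw [F_succ hmn', F_succ hmn'] at hlast ⊢
  set z := S.f n (S.F m n x) - S.f n (S.F m n y) with hz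
  set q := ‖projU h2 n (S.F m n x - S.F m n y)‖
  obtain ⟨hlu, hls, -⟩ := h4 n
  rw [abs_le] at hlu hls
  have hγ := (H.step n).γ_pos
  have hε := (H.step n).ε_pos
  have hq : q ≤ Real.exp (L + η) * ‖projU h2 (n + 1) z‖ := by
    have h1 : Real.exp (-(L + η)) * q ≤ ‖projU h2 (n + 1) z‖ := by
      refine le_trans (mul_le_mul_of_nonneg_right ?_ (norm_nonneg _)) hu
      exact (Real.exp_le_exp.2 (by linarith)).trans (H.rate_le n)
    rw [Real.exp_neg, inv_mul_eq_div, div_le_iff₀ (Real.exp_pos _)] at h1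
    linarith
  -- The images at the last time may lie outside the domain of the next graph, so its slope bound is
  -- not available; the cone estimate for the last map replaces it.
  have hs' : ‖projS h2 (n + 1) z‖ ≤ (1 - Real.exp (-η)) * ‖projU h2 (n + 1) z‖ := by
    have e2 : Real.exp (S.ls n) ≤ Real.exp L := Real.exp_le_exp.2 hls.2
    calc _ ≤ (Real.exp (S.ls n) * γ + ε) * q := hs
      _ ≤ (Real.exp L * γ + ε) * (Real.exp (L + η) * ‖projU h2 (n + 1) z‖) := by gcongr
      _ = (Real.exp L * γ + ε) * Real.exp (L + η) * ‖projU h2 (n + 1) z‖ := by ring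
      _ ≤ _ := by gcongr
  have hzn : Real.exp (-η) * ‖projU h2 (n + 1) z‖ ≤ ‖z‖ := by
    have e := sumMap_proj h2 (n + 1) z
    rw [sumMap_apply] at e
    have h1 := norm_sub_norm_le (projU h2 (n + 1) z : 𝔼) (-(projS h2 (n + 1) z : 𝔼))
    rw [sub_neg_eq_add, e, norm_neg, ← Submodule.coe_norm, ← Submodule.coe_norm] at h1
    linarith
  set t := ∑ j ∈ Finset.Ico m (n + 1), (S.lu j - η)
  have hxy : Real.exp (-η) * ‖x - y‖ ≤ ‖projU h2 m (x - y)‖ := by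
    rw [Real.exp_neg, inv_mul_eq_div, div_le_iff₀ (Real.exp_pos _), mul_comm]
    refine h0.trans (mul_le_mul_of_nonneg_right ?_ (norm_nonneg _))
    linarith [Real.add_one_le_exp η]
  calc Real.exp (t - 2 * η) * ‖x - y‖
      = Real.exp (-η) * (Real.exp t * (Real.exp (-η) * ‖x - y‖)) := by
        rw [← mul_assoc, ← mul_assoc, ← Real.exp_add, ← Real.exp_add]
        ring_nf
    _ ≤ Real.exp (-η) * ‖projU h2 (n + 1) z‖ := by
        refine mul_le_mul_of_nonneg_left (le_trans ?_ hlast) (Real.exp_pos _).le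
        gcongr
    _ ≤ ‖z‖ := hzn

/-- All graphs pass through `0`, so distances can be measured relative to `‖v‖`. Each step contracts
this ratio by `exp (ls - lu + 2 * η)`: the `s`-contraction, and the expansion of the base point. -/
theorem norm_sub_le_exp (hφ : S.IsGraphTransformOrbit α r κ φ) (n : ℕ) :
    ∀ v ∈ ball (0 : S.Eu n) (r n), ‖ψ n v - φ n v‖ ≤
      2 * γ * Real.exp (∑ j ∈ Finset.range n, (S.ls j - S.lu j + 2 * η)) * ‖v‖ := by
  have hγ := (H.step 0).γ_pos
  induction n with
  | zero =>
    intro v hv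
    have h1 := IsAdmissible.norm_le (hψ.cHat 0) (H.step 0).α_pos (H.step 0).κ_pos.le hv
    have h2' := IsAdmissible.norm_le (hφ.cHat 0) (H.step 0).α_pos (H.step 0).κ_pos.le hv
    rw [(H.step 0).κ_mul] at h1 h2'
    have := _root_.norm_sub_le (ψ 0 v) (φ 0 v)
    simp only [Finset.range_zero, Finset.sum_empty, Real.exp_zero, mul_one]
    linarith
  | succ n ih =>
    intro v hv
    have h1 := (H.step n).norm_graphTransform_sub_le (hψ.cHat n) (hφ.cHat n) (by positivity) ih hv
    rw [H.eqOn_graphTransform n (hψ.cHat n) (hψ.2 n) hv,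
      H.eqOn_graphTransform n (hφ.cHat n) (hφ.2 n) hv] at h1
    refine h1.trans (mul_le_mul_of_nonneg_right ?_ (norm_nonneg v))
    have h3 : Real.exp (S.ls n + η) / (Real.exp (S.lu n) - ε) ≤
        Real.exp (S.ls n - S.lu n + 2 * η) := by
      have : Real.exp (S.ls n - S.lu n + 2 * η) =
          Real.exp (S.ls n + η) / Real.exp (S.lu n - η) := by
        rw [← Real.exp_sub]
        ring_nf
      rw [this]
      exact div_le_div_of_nonneg_left (Real.exp_pos _).le (Real.exp_pos _) (H.rate_le n)
    rw [Finset.sum_range_succ, Real.exp_add _ (S.ls n - S.lu n + 2 * η)]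
    calc _ ≤ Real.exp (S.ls n - S.lu n + 2 * η) *
        (2 * γ * Real.exp (∑ j ∈ Finset.range n, (S.ls j - S.lu j + 2 * η))) := by gcongr
      _ = _ := by ring

/-- Of the `3 * η`, two come from the rate in `norm_sub_le_exp`, and one absorbs the constant `log
(2 * γ * R) / n`. -/
theorem limsup_log_c0Dist_lt (hφ : S.IsGraphTransformOrbit α r κ φ) {L R χ χ' : ℝ}
    (h4 : S.C4 L) (hχ : χ < S.chiG) (hη : 0 < η) (hηχ : 3 * η < χ - χ') (hR : 0 < R)
    {Γ : Set ℕ} (hΓ : ∀ n ∈ Γ, 0 < n ∧ r n = R) :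
    Filter.limsup (fun n : ℕ => (((1 / (n : ℝ) : ℝ)) : EReal) *
      ENNReal.log (S.c0Dist n R (ψ n) (φ n))) (atTop ⊓ 𝓟 Γ) < ((-χ' : ℝ) : EReal) := by
  have hγ := (H.step 0).γ_pos
  have hL : ∀ j, -(2 * L) ≤ S.lu j - S.ls j := fun j => by
    have h1 := abs_le.1 (h4 j).1
    have h2 := abs_le.1 (h4 j).2.1
    linarith
  have hbdd : IsBoundedUnder (· ≥ ·) atTop
      (fun n : ℕ => 1 / (n : ℝ) * ∑ k ∈ Finset.range n, (S.lu k - S.ls k)) := by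
    refine isBoundedUnder_of ⟨min (-(2 * L)) 0, fun n => ?_⟩
    rcases Nat.eq_zero_or_pos n with rfl | hn
    · simp
    have hn' : (0 : ℝ) < n := by exact_mod_cast hn
    have := Finset.card_nsmul_le_sum (Finset.range n) _ _ (fun j _ => hL j)
    rw [Finset.card_range, nsmul_eq_mul] at this
    refine (min_le_left _ _).trans ?_
    rw [one_div, inv_mul_eq_div, le_div_iff₀ hn']
    linarith
  have hlim : Tendsto (fun n : ℕ => Real.log (2 * γ * R) / (n : ℝ)) atTop (𝓝 0) :=
    tendsto_const_div_atTop_nhds_zero_nat _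
  have hle : ∀ᶠ n : ℕ in atTop ⊓ 𝓟 Γ, (((1 / (n : ℝ) : ℝ)) : EReal) *
      ENNReal.log (S.c0Dist n R (ψ n) (φ n)) ≤ ((-χ + 3 * η : ℝ) : EReal) := by
    rw [eventually_inf_principal]
    filter_upwards [eventually_lt_of_lt_liminf hχ hbdd, hlim.eventually (gt_mem_nhds hη)]
      with n hn1 hn2 hnΓ
    obtain ⟨hn0, hrn⟩ := hΓ n hnΓ
    have hn' : (0 : ℝ) < n := by exact_mod_cast hn0
    set s := ∑ j ∈ Finset.range n, (S.ls j - S.lu j + 2 * η) with hs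
    have hs' : s = -(∑ k ∈ Finset.range n, (S.lu k - S.ls k)) + n * (2 * η) := by
      rw [hs, Finset.sum_add_distrib, ← Finset.sum_neg_distrib]
      simp
    have hdist : S.c0Dist n R (ψ n) (φ n) ≤ ENNReal.ofReal (2 * γ * R * Real.exp s) := by
      refine iSup₂_le fun v hv => ?_
      rw [← ofReal_norm]
      refine ENNReal.ofReal_le_ofReal ?_
      have hvR : ‖v‖ < R := by simpa using hv
      refine (H.norm_sub_le_exp hψ hφ n v (by rwa [hrn])).trans ?_
      calc _ ≤ 2 * γ * Real.exp s * R := by gcongr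
        _ = _ := by ring
    have hlog : ENNReal.log (S.c0Dist n R (ψ n) (φ n)) ≤
        ((Real.log (2 * γ * R) + s : ℝ) : EReal) := by
      refine (ENNReal.log_monotone hdist).trans_eq ?_
      rw [ENNReal.log_ofReal_of_pos (by positivity), Real.log_mul (by positivity)
        (Real.exp_pos _).ne', Real.log_exp]
    refine (mul_le_mul_of_nonneg_left hlog (by exact_mod_cast (by positivity))).trans ?_
    rw [← EReal.coe_mul, EReal.coe_le_coe_iff]
    rw [one_div, inv_mul_eq_div, lt_div_iff₀ hn'] at hn1
    rw [div_lt_iff₀ hn'] at hn2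
    rw [one_div, inv_mul_eq_div, div_le_iff₀ hn', hs']
    nlinarith
  refine (limsup_le_of_le (by isBoundedDefault) hle).trans_lt ?_
  exact_mod_cast (by linarith)

end AdmissibleRadii

end MapSequence

/-! ### Truncated radii and effective rates. -/

/-- The radii obtained from `R` by multiplying at each step by `exp (q n)` and truncating at
`R`. -/
noncomputable def truncatedRadius (R : ℝ) (q : ℕ → ℝ) : ℕ → ℝ
  | 0 => R
  | n + 1 => min R (Real.exp (q n) * truncatedRadius R q n)

namespace truncatedRadius

variable {R : ℝ} {q : ℕ → ℝ}

lemma pos (hR : 0 < R) (n : ℕ) : 0 < truncatedRadius R q n := by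
  induction n with
  | zero => exact hR
  | succ n ih => exact lt_min hR (mul_pos (Real.exp_pos _) ih)

lemma le (n : ℕ) : truncatedRadius R q n ≤ R := by
  cases n with
  | zero => exact le_rfl
  | succ n => exact min_le_left _ _

lemma succ_le (n : ℕ) : truncatedRadius R q (n + 1) ≤ Real.exp (q n) * truncatedRadius R q n :=
  min_le_right _ _

/-- Here `k` is the last time the radius was reset to `R`, or `0`. -/
lemma exists_eq (n : ℕ) :
    ∃ k ≤ n, truncatedRadius R q n = R * Real.exp (∑ j ∈ Finset.Ico k n, q j) := by
  induction n with
  | zero => exact ⟨0, le_rfl, by simp [truncatedRadius]⟩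
  | succ n ih =>
    rcases min_choice R (Real.exp (q n) * truncatedRadius R q n) with h | h
    · exact ⟨n + 1, le_rfl, by simpa [truncatedRadius] using h⟩
    · obtain ⟨k, hk, e⟩ := ih
      refine ⟨k, by omega, ?_⟩
      rw [truncatedRadius, h, e, Finset.sum_Ico_succ_top hk, Real.exp_add]
      ring

lemma eq_of_sum_nonneg (hR : 0 < R) {n : ℕ} (h : ∀ k ≤ n, 0 ≤ ∑ j ∈ Finset.Ico k n, q j) :
    truncatedRadius R q n = R := by
  obtain ⟨k, hk, e⟩ := exists_eq (R := R) (q := q) n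
  refine (le n).antisymm ?_
  rw [e]
  exact le_mul_of_one_le_right hR.le (Real.one_le_exp (h k hk))

end truncatedRadius

namespace MapSequence

variable {d : ℕ} {S : MapSequence d} {α L βbar : ℝ}

lemma defect_nonneg (n : ℕ) : 0 ≤ S.defect α n := le_max_left _ _

lemma le_defect_mul (hα : 0 < α) (n : ℕ) : S.ls n - S.lu n ≤ α * S.defect α n := by
  have : (S.ls n - S.lu n) / α ≤ S.defect α n := le_max_right _ _
  rw [div_le_iff₀ hα] at this
  linarith

lemma lamE_le (n : ℕ) : S.lamE α βbar n ≤ S.lu n - S.defect α n := by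
  unfold lamE
  split_ifs
  · exact le_rfl
  · exact min_le_left _ _

lemma lamE_le_lu (n : ℕ) : S.lamE α βbar n ≤ S.lu n := by
  linarith [lamE_le (S := S) (α := α) (βbar := βbar) n, defect_nonneg (S := S) (α := α) n]

/-- Needed for the boundedness of the averages whose lower limit is `chiE`. The logarithmic term is
at least `-L / α` by (C4). -/
lemma le_lamE (hα : 0 < α) (h3 : S.C3 α) (h4 : S.C4 L) (hβ0 : S.β 0 ≤ βbar) (n : ℕ) :
    -L - 2 * L / α ≤ S.lamE α βbar n := by
  have hlu := abs_le.1 (h4 n).1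
  have hls := abs_le.1 (h4 n).2.1
  have hL : 0 ≤ L := (abs_nonneg _).trans (h4 n).1
  have hLα : 0 ≤ L / α := by positivity
  have e2 : 2 * L / α = L / α + L / α := by ring
  have hdef : S.defect α n ≤ 2 * L / α := by
    refine max_le (by positivity) ?_
    gcongr
    linarith
  have h1 : -L - 2 * L / α ≤ S.lu n - S.defect α n := by linarith
  unfold lamE
  split_ifs with h
  · exact h1
  · refine le_min h1 ?_
    obtain ⟨m, rfl⟩ : ∃ m, n = m + 1 := ⟨n - 1, by
      have : n ≠ 0 := by
        rintro rfl
        exact h hβ0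
      omega⟩
    rw [Nat.add_sub_cancel]
    have hm := (h3 m).2.1
    have hm1 := (h3 (m + 1)).2.1
    have hlog : -L ≤ Real.log (S.β m / S.β (m + 1)) := by
      rw [Real.le_log_iff_exp_le (div_pos hm hm1), le_div_iff₀ hm1, Real.exp_neg, inv_mul_eq_div,
        div_le_iff₀ (Real.exp_pos _), mul_comm]
      exact (h4 m).2.2
    have : 1 / α * (-L) ≤ 1 / α * Real.log (S.β m / S.β (m + 1)) := by gcongr
    have e : 1 / α * (-L) = -(L / α) := by ring
    linarith

variable (S) in
/-- The domain sizes `r n`. -/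
noncomputable def radius (α βbar δ rbar : ℝ) : ℕ → ℝ :=
  truncatedRadius rbar (fun n => S.lamE α βbar n - δ)

variable {δ rbar : ℝ}

lemma radius_rpow_succ_le (hα : 0 < α) (hr : 0 < rbar) (n : ℕ) :
    S.radius α βbar δ rbar (n + 1) ^ α ≤
      Real.exp (α * (S.lamE α βbar n - δ)) * S.radius α βbar δ rbar n ^ α := by
  have h0 : 0 < S.radius α βbar δ rbar n := truncatedRadius.pos hr n
  refine (Real.rpow_le_rpow (truncatedRadius.pos hr (n + 1)).le
    (truncatedRadius.succ_le n) hα.le).trans_eq ?_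
  rw [Real.mul_rpow (Real.exp_pos _).le (truncatedRadius.pos hr n).le, ← Real.exp_mul, mul_comm α]
  rfl

/-- When `β` exceeds the threshold, the logarithmic term in `lamE` makes `r ^ α` shrink at least as
fast as `β` grows. The indices are shifted because the rate with index `n` compares `β (n - 1)` with
`β n` but links `r n` to `r (n + 1)`. -/
lemma beta_mul_radius_succ_le (hα : 0 < α) (hδ : 0 ≤ δ) (hr : 0 < rbar) (h3 : S.C3 α)
    (hβ : 0 < βbar) (hβ0 : S.β 0 ≤ βbar) (n : ℕ) :
    S.β n * S.radius α βbar δ rbar (n + 1) ^ α ≤ βbar * rbar ^ α := by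
  have hle : ∀ n, S.radius α βbar δ rbar n ^ α ≤ rbar ^ α := fun n =>
    Real.rpow_le_rpow (truncatedRadius.pos hr n).le (truncatedRadius.le n) hα.le
  have hnn : ∀ n, 0 ≤ S.radius α βbar δ rbar n ^ α := fun n =>
    Real.rpow_nonneg (truncatedRadius.pos hr n).le _
  induction n with
  | zero => exact mul_le_mul hβ0 (hle 1) (hnn 1) hβ.le
  | succ n ih =>
    by_cases h : S.β (n + 1) ≤ βbar
    · exact mul_le_mul h (hle _) (hnn _) hβ.le
    · refine le_trans ?_ ih
      have hn := (h3 n).2.1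
      have hn1 := (h3 (n + 1)).2.1
      have hlam : S.lamE α βbar (n + 1) ≤ 1 / α * Real.log (S.β n / S.β (n + 1)) := by
        unfold lamE
        rw [if_neg h]
        exact min_le_right _ _
      have hexp : Real.exp (α * (S.lamE α βbar (n + 1) - δ)) ≤ S.β n / S.β (n + 1) := by
        rw [← Real.le_log_iff_exp_le (div_pos hn hn1)]
        rw [one_div, inv_mul_eq_div, le_div_iff₀ hα] at hlam
        nlinarith [mul_nonneg hα.le hδ]
      calc _ ≤ S.β (n + 1) * (S.β n / S.β (n + 1) * S.radius α βbar δ rbar (n + 1) ^ α) := by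
            refine mul_le_mul_of_nonneg_left ((radius_rpow_succ_le hα hr (n + 1)).trans ?_) hn1.le
            exact mul_le_mul_of_nonneg_right hexp (hnn _)
        _ = _ := by field_simp

lemma beta_mul_radius_le (hα : 0 < α) (hδ : 0 ≤ δ) (hr : 0 < rbar) (h3 : S.C3 α)
    (h4 : S.C4 L) (hβ : 0 < βbar) (hβ0 : S.β 0 ≤ βbar) (n : ℕ) :
    S.β n * S.radius α βbar δ rbar n ^ α ≤ Real.exp L * βbar * rbar ^ α := by
  have hL : 0 ≤ L := (abs_nonneg _).trans (h4 0).1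
  have hra : 0 < rbar ^ α := Real.rpow_pos_of_pos hr _
  cases n with
  | zero =>
    change S.β 0 * rbar ^ α ≤ _
    have : S.β 0 ≤ Real.exp L * βbar := hβ0.trans
      (le_mul_of_one_le_left hβ.le (Real.one_le_exp hL))
    gcongr
  | succ n =>
    have h0 : 0 ≤ S.radius α βbar δ rbar (n + 1) ^ α :=
      Real.rpow_nonneg (truncatedRadius.pos hr _).le _
    calc _ ≤ Real.exp L * S.β n * S.radius α βbar δ rbar (n + 1) ^ α := by
          gcongr
          exact (h4 n).2.2
      _ = Real.exp L * (S.β n * S.radius α βbar δ rbar (n + 1) ^ α) := by ring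
      _ ≤ Real.exp L * (βbar * rbar ^ α) := by
          exact mul_le_mul_of_nonneg_left (beta_mul_radius_succ_le hα hδ hr h3 hβ hβ0 n)
            (Real.exp_pos L).le
      _ = _ := by ring

/-- Every sum of `lamE - δ` over an interval ending at `n` is nonnegative, so whatever the last
reset, the radius is back at `rbar`. -/
lemma radius_eq_of_mem_effHypTimes {χ : ℝ} (hr : 0 < rbar) (hδχ : δ ≤ χ) {n : ℕ}
    (hn : n ∈ S.effHypTimes α βbar χ) : S.radius α βbar δ rbar n = rbar := by
  refine truncatedRadius.eq_of_sum_nonneg hr fun k hk => ?_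
  have := sum_le_of_mem_averageTimes (a := S.lamE α βbar) hn hk
  rw [Finset.sum_sub_distrib, Finset.sum_const, Nat.card_Ico, nsmul_eq_mul, Nat.cast_sub hk]
  have h0 : (0 : ℝ) ≤ (n : ℝ) - k := sub_nonneg.2 (by exact_mod_cast hk)
  nlinarith

/-- The auxiliary radii with `δ = 0` and `rbar = 1` equal `1` at time `n`, which gives `β (n - 1) ≤
βbar`; then (C3) yields `1 ≤ βbar * sin (θ n)`. -/
lemma inv_le_angle_of_mem_effHypTimes {χ : ℝ} (hα : 0 < α) (h3 : S.C3 α) (hβ : 0 < βbar)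
    (hβ0 : S.β 0 ≤ βbar) (hχ : 0 ≤ χ) {n : ℕ} (hn : n ∈ S.effHypTimes α βbar χ) :
    βbar⁻¹ ≤ S.θ n := by
  have hrad := radius_eq_of_mem_effHypTimes (δ := 0) one_pos hχ hn
  obtain ⟨m, rfl⟩ : ∃ m, n = m + 1 := ⟨n - 1, by have := hn.1; omega⟩
  have h1 := beta_mul_radius_succ_le hα (le_refl (0 : ℝ)) one_pos h3 hβ hβ0 m
  rw [hrad, Real.one_rpow, mul_one, mul_one] at h1
  have hsin := sin_pos h3 m
  have h2 := (h3 m).2.2.2.2.2.1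
  have h4 := Real.sin_le (h3 (m + 1)).1.le
  rw [inv_le_iff_one_le_mul₀ hβ]
  nlinarith

/-- The radii `r n = radius n` and the Hölder constants `κ n` for which `κ n * r n ^ α` does not
depend on `n` are such that all graph transforms are defined. -/
theorem admissibleRadii_radius {ε η κbar : ℝ} (h1 : S.C1 α) (h2 : S.C2) (h3 : S.C3 α)
    (h4 : S.C4 L) (h5 : S.C5 rbar (κbar * rbar ^ α)) (hα0 : 0 < α) (hα1 : α ≤ 1)
    (hη : 0 < η) (hδ : α * δ = 3 * η) (hε : 0 < ε)
    (hε1 : ε ≤ Real.exp (-L) * (1 - Real.exp (-η)))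
    (hε2 : 2 * ε + 2 * ε * (Real.exp L * (κbar * rbar ^ α) + ε) * Real.exp (L + η) ≤
      Real.exp (-L) * (Real.exp η - 1))
    (hr : 0 < rbar) (hκ : 0 < κbar) (hγ1 : κbar * rbar ^ α ≤ 1)
    (hβ : 0 < βbar) (hβ0 : S.β 0 ≤ βbar) (hrε : 4 * Real.exp L * βbar * rbar ^ α ≤ ε)
    (hκε : 4 * Real.exp L * βbar ≤ ε * κbar) :
    AdmissibleRadii h2 α ε η (κbar * rbar ^ α) (S.radius α βbar δ rbar)
      (fun n => κbar * rbar ^ α / S.radius α βbar δ rbar n ^ α) := by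
  have hδ0 : 0 ≤ δ := by
    by_contra! hc
    nlinarith
  have hηδ : η ≤ δ := by nlinarith
  have hra : 0 < rbar ^ α := Real.rpow_pos_of_pos hr _
  have key : ∀ n, _ := fun n => by
    have hpos : ∀ n, 0 < S.radius α βbar δ rbar n := fun n => truncatedRadius.pos hr n
    have hpa : ∀ n, 0 < S.radius α βbar δ rbar n ^ α := fun n => Real.rpow_pos_of_pos (hpos n) _
    have hb := beta_mul_radius_le hα0 hδ0 hr h3 h4 hβ hβ0 n
    have hlam := lamE_le (S := S) (α := α) (βbar := βbar) n
    have hd0 := defect_nonneg (S := S) (α := α) n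
    have hd := le_defect_mul (S := S) hα0 n
    have hrr : S.radius α βbar δ rbar n ≤ rbar := truncatedRadius.le n
    refine hyperbolicStep h2 h1 h3 h4 hα0 hα1 (n := n) (r := S.radius α βbar δ rbar n)
      (κ := κbar * rbar ^ α / S.radius α βbar δ rbar n ^ α) (r' := S.radius α βbar δ rbar (n + 1))
      (κ' := κbar * rbar ^ α / S.radius α βbar δ rbar (n + 1) ^ α) (γ := κbar * rbar ^ α)
      hη hε hε1 hε2 (hpos n) (div_pos (mul_pos hκ hra) (hpa n)) (hpos (n + 1))
      (div_mul_cancel₀ _ (hpa n).ne') hγ1 ?_ ?_ ?_ ?_ ?_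
    · refine subset_trans ?_ (h5 n)
      rintro x ⟨v, hv, w, hw, hvr, hwr, rfl⟩
      exact ⟨v, hv, w, hw, hvr.trans_le hrr, hwr.trans_le (by gcongr), rfl⟩
    · linarith
    · rw [mul_div_assoc', le_div_iff₀ (hpa n)]
      nlinarith
    · refine (truncatedRadius.succ_le n).trans ?_
      refine mul_le_mul_of_nonneg_right (Real.exp_le_exp.2 ?_) (hpos n).le
      linarith
    · rw [le_div_iff₀ (hpa (n + 1))]
      have hstep := radius_rpow_succ_le (S := S) (α := α) (βbar := βbar) (δ := δ) hα0 hr n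
      -- The losses in the first exponent add up to `(2 + α) * η ≤ 3 * η = α * δ`, and the defect
      -- gives `α * lamE ≤ (1 + α) * lu - ls`.
      have hexp : Real.exp (S.ls n + η - (1 + α) * (S.lu n - η)) *
          Real.exp (α * (S.lamE α βbar n - δ)) ≤ 1 := by
        rw [← Real.exp_add, Real.exp_le_one_iff]
        nlinarith
      have hg : 0 < κbar * rbar ^ α := mul_pos hκ hra
      calc _ ≤ κbar * rbar ^ α / S.radius α βbar δ rbar n ^ α *
            Real.exp (S.ls n + η - (1 + α) * (S.lu n - η)) *
            (Real.exp (α * (S.lamE α βbar n - δ)) * S.radius α βbar δ rbar n ^ α) :=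
          mul_le_mul_of_nonneg_left hstep
            (mul_nonneg (div_pos hg (hpa n)).le (Real.exp_pos _).le)
        _ = κbar * rbar ^ α * (Real.exp (S.ls n + η - (1 + α) * (S.lu n - η)) *
            Real.exp (α * (S.lamE α βbar n - δ))) := by
          have := (hpa n).ne'
          field_simp
        _ ≤ _ := mul_le_of_le_one_right hg.le hexp
  exact ⟨fun n => (key n).1, fun n => (key n).2⟩

end MapSequence

/-! ### Choice of constants and conclusion. -/

/-- Constants `ε`, `γ₀` so small that the conditions of the graph transform and of the invariance of
cones hold. -/
lemma exists_smallness_constants {L η : ℝ} (hη : 0 < η) :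
    ∃ ε γ₀ : ℝ, 0 < ε ∧ 0 < γ₀ ∧ γ₀ ≤ 1 ∧ γ₀ ≤ η ∧
      ε ≤ Real.exp (-L) * (1 - Real.exp (-η)) ∧
      ∀ γ, 0 < γ → γ ≤ γ₀ →
        2 * ε + 2 * ε * (Real.exp L * γ + ε) * Real.exp (L + η) ≤
          Real.exp (-L) * (Real.exp η - 1) ∧
        (Real.exp L * γ + ε) * Real.exp (L + η) ≤ 1 - Real.exp (-η) := by
  have h1 : 0 < 1 - Real.exp (-η) := by simpa using hη
  have h2 : 0 < Real.exp η - 1 := by simpa using hη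
  set K := Real.exp L
  set M := Real.exp (L + η)
  have hK : 0 < K := Real.exp_pos _
  have hM : 0 < M := Real.exp_pos _
  set ε₁ := Real.exp (-L) * (1 - Real.exp (-η))
  set ε₂ := Real.exp (-L) * (Real.exp η - 1) / (2 + 2 * (K + 1) * M)
  -- Half of the cone budget: `ε` and `K * γ` may each use up to `ε₃`.
  set ε₃ := (1 - Real.exp (-η)) / (2 * M)
  have hε₁ : 0 < ε₁ := by positivity
  have hε₂ : 0 < ε₂ := by positivity
  have hε₃ : 0 < ε₃ := by positivity
  set ε := min (min 1 ε₁) (min ε₂ ε₃)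
  have hε : 0 < ε := lt_min (lt_min one_pos hε₁) (lt_min hε₂ hε₃)
  have e1 : ε ≤ 1 := (min_le_left _ _).trans (min_le_left _ _)
  have e2 : ε ≤ ε₁ := (min_le_left _ _).trans (min_le_right _ _)
  have e3 : ε ≤ ε₂ := (min_le_right _ _).trans (min_le_left _ _)
  have e4 : ε ≤ ε₃ := (min_le_right _ _).trans (min_le_right _ _)
  refine ⟨ε, min (min 1 η) (ε₃ / K), hε, by positivity,
    (min_le_left _ _).trans (min_le_left _ _), (min_le_left _ _).trans (min_le_right _ _), e2,
    fun γ hγ0 hγ => ?_⟩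
  have g1 : γ ≤ 1 := hγ.trans ((min_le_left _ _).trans (min_le_left _ _))
  have g2 : K * γ ≤ ε₃ := by
    have := hγ.trans (min_le_right _ _)
    rw [le_div_iff₀ hK] at this
    linarith
  constructor
  · have h3 : K * γ + ε ≤ K + 1 := by nlinarith
    rw [le_div_iff₀ (by positivity)] at e3
    calc _ ≤ 2 * ε + 2 * ε * (K + 1) * M := by gcongr
      _ = ε * (2 + 2 * (K + 1) * M) := by ring
      _ ≤ _ := e3
  · have h3 : K * γ + ε ≤ 2 * ε₃ := by linarith
    calc _ ≤ 2 * ε₃ * M := by gcongr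
      _ = _ := by
        simp only [ε₃]
        field_simp

theorem theoremA (βbar L α χuHat χuBar χgHat χgBar : ℝ)
    (hβ : 0 < βbar) (hL : 0 < L) (hα0 : 0 < α) (hα1 : α ≤ 1)
    (hu0 : 0 < χuBar) (hu : χuBar < χuHat) (hg0 : 0 < χgBar) (hg : χgBar < χgHat) :
    ∃ γt rt θt κt : ℝ, 0 < γt ∧ 0 < rt ∧ 0 < θt ∧ 0 < κt ∧
    ∀ γbar rbar θbar κbar : ℝ, 0 < γbar → γbar ≤ γt → 0 < rbar → rbar ≤ rt →
      0 < θbar → θbar ≤ θt → κt ≤ κbar → κbar * rbar ^ α ≤ γbar →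
    ∀ (d : ℕ) (S : MapSequence d),
      S.C1 α → S.C2 → S.C3 α → S.C4 L → S.C5 rbar (κbar * rbar ^ α) →
      S.β 0 ≤ βbar → χuHat < S.chiE α βbar →
      -- lower density of the set of effective hyperbolic times
      (0 < (S.chiE α βbar - χuHat) / (L - χuHat) ∧
        (S.chiE α βbar - χuHat) / (L - χuHat) ≤ lowerDensity (S.effHypTimes α βbar χuHat)) ∧
      -- control of the angle
      (∀ n ∈ S.effHypTimes α βbar χuHat, θbar ≤ S.θ n) ∧
      -- parameters for which all graph transforms are defined, uniform on the effective times
      ∃ r κ : ℕ → ℝ,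
        (∀ n, 0 < r n ∧ r n ≤ rbar ∧ 0 < κ n ∧ κ n * r n ^ α ≤ κbar * rbar ^ α) ∧
        r 0 = rbar ∧ κ 0 = κbar ∧
        (∀ n ∈ S.effHypTimes α βbar χuHat, r n = rbar ∧ κ n = κbar) ∧
        (∀ n, S.GraphTransformDefined α r κ n) ∧
        -- the images of an admissible function at effective hyperbolic times
        (∀ ψ : ∀ n, S.Eu n → S.Es n, S.IsGraphTransformOrbit α r κ ψ →
          ∀ n ∈ S.effHypTimes α βbar χuHat,
            S.CHat α n rbar κbar (ψ n) ∧
            (∀ v ∈ Metric.ball (0 : S.Eu n) rbar, ‖fderiv ℝ (ψ n) v‖ ≤ γbar) ∧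
            S.graph n rbar (ψ n) =
              S.F 0 n '' (S.graph 0 rbar (ψ 0) ∩
                S.orbitDomain (fun k => S.box k (r k) (κ k * r k ^ α * r k)) 0 n) ∩
              S.cylinder n rbar ∧
            ∀ m ≤ n, ∀ x y : EuclideanSpace ℝ (Fin d),
              x ∈ S.graph m (r m) (ψ m) ∩
                S.orbitDomain (fun k => S.box k (r k) (κ k * r k ^ α * r k)) m n →
              y ∈ S.graph m (r m) (ψ m) ∩
                S.orbitDomain (fun k => S.box k (r k) (κ k * r k ^ α * r k)) m n →
              Real.exp (((n : ℝ) - (m : ℝ)) * χuBar) * ‖x - y‖ ≤ ‖S.F m n x - S.F m n y‖) ∧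
        -- exponential convergence under asymptotic domination
        (χgHat < S.chiG →
          ∀ ψ φ : ∀ n, S.Eu n → S.Es n,
            S.IsGraphTransformOrbit α r κ ψ → S.IsGraphTransformOrbit α r κ φ →
            Filter.limsup
              (fun n : ℕ => (((1 / (n : ℝ) : ℝ)) : EReal) *
                ENNReal.log (S.c0Dist n rbar (ψ n) (φ n)))
              (Filter.atTop ⊓ Filter.principal (S.effHypTimes α βbar χuHat))
              < ((-χgBar : ℝ) : EReal)) := by
  -- The first bound gives `δ = 3 * η / α ≤ χuHat - χuBar`; the divisor `4` makes the gap in the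
  -- second rate strictly larger than `3 * η`.
  set η := min (α * (χuHat - χuBar) / 3) ((χgHat - χgBar) / 4) with hηdef
  have hη : 0 < η := lt_min (by have := sub_pos.2 hu; positivity) (by linarith)
  have hη1 : 3 * η ≤ α * (χuHat - χuBar) := by
    have : η ≤ α * (χuHat - χuBar) / 3 := min_le_left _ _
    linarith
  have hη2 : 3 * η < χgHat - χgBar := by
    have : η ≤ (χgHat - χgBar) / 4 := min_le_right _ _
    linarith
  obtain ⟨ε, γ₀, hε, hγ₀, hγ₀1, hγ₀η, hε1, hsmall⟩ := exists_smallness_constants (L := L) hη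
  have hc : 0 < 4 * Real.exp L * βbar := by positivity
  -- The radius threshold encodes `4 * exp L * βbar * rbar ^ α ≤ ε` and the last one `4 * exp L *
  -- βbar ≤ ε * κbar`.
  refine ⟨γ₀, (ε / (4 * Real.exp L * βbar)) ^ (1 / α), βbar⁻¹, 4 * Real.exp L * βbar / ε, hγ₀,
    by positivity, inv_pos.2 hβ, by positivity, ?_⟩
  intro γbar rbar θbar κbar _ hγbar hr hrt _ hθ hκt hκγ d S h1 h2 h3 h4 h5 hβ0 hχ
  have hκ : 0 < κbar := lt_of_lt_of_le (by positivity) hκt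
  have hra : 0 < rbar ^ α := Real.rpow_pos_of_pos hr _
  have hg : 0 < κbar * rbar ^ α := mul_pos hκ hra
  obtain ⟨hs1, hs2⟩ := hsmall _ hg (hκγ.trans hγbar)
  have hrε : 4 * Real.exp L * βbar * rbar ^ α ≤ ε := by
    have := Real.rpow_le_rpow hr.le hrt hα0.le
    rw [← Real.rpow_mul (by positivity), one_div, inv_mul_cancel₀ hα0.ne', Real.rpow_one,
      le_div_iff₀ hc] at this
    linarith
  have hκε : 4 * Real.exp L * βbar ≤ ε * κbar := by
    rw [div_le_iff₀ hε] at hκt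
    linarith
  set δ := 3 * η / α with hδdef
  have hδ : α * δ = 3 * η := mul_div_cancel₀ _ hα0.ne'
  have hδχ : δ ≤ χuHat - χuBar := by
    rw [hδdef, div_le_iff₀ hα0]
    linarith
  have H := MapSequence.admissibleRadii_radius h1 h2 h3 h4 h5 hα0 hα1 hη hδ hε hε1 hs1 hr hκ
    (hκγ.trans (hγbar.trans hγ₀1)) hβ hβ0 hrε hκε
  have hrad : ∀ n ∈ S.effHypTimes α βbar χuHat, S.radius α βbar δ rbar n = rbar := fun n hn =>
    MapSequence.radius_eq_of_mem_effHypTimes hr (by linarith) hn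
  obtain ⟨hχL, hdens⟩ := pliss (a := S.lamE α βbar) (χ := χuHat) (L := L)
    (fun j => (MapSequence.lamE_le_lu j).trans (abs_le.1 (h4 j).1).2)
    (MapSequence.le_lamE hα0 h3 h4 hβ0) hχ
  refine ⟨⟨div_pos (sub_pos.2 hχ) (sub_pos.2 hχL), hdens⟩, fun n hn => hθ.trans
    (MapSequence.inv_le_angle_of_mem_effHypTimes hα0 h3 hβ hβ0 (hu0.trans hu).le hn),
    S.radius α βbar δ rbar, fun n => κbar * rbar ^ α / S.radius α βbar δ rbar n ^ α,
    fun n => ⟨(H.step n).r_pos, truncatedRadius.le n, (H.step n).κ_pos, (H.step n).κ_mul.le⟩,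
    rfl, mul_div_cancel_right₀ _ hra.ne', fun n hn => ⟨hrad n hn, ?_⟩,
    H.graphTransformDefined, ?_, ?_⟩
  · simp only [hrad n hn]
    exact mul_div_cancel_right₀ _ hra.ne'
  · intro ψ hψ n hn
    have hcH : S.CHat α n rbar κbar (ψ n) := by
      have := hψ.cHat n
      simp only [hrad n hn, mul_div_cancel_right₀ κbar hra.ne'] at this
      exact this
    refine ⟨hcH, fun v hv => (IsAdmissible.norm_fderiv_le hcH hα0 hκ.le hv).trans hκγ, ?_, ?_⟩
    · have := H.graph_eq_image hψ hn.1
      rwa [hrad n hn, show S.radius α βbar δ rbar 0 = rbar from rfl] at this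
    · intro m hmn x y hx hy
      rcases hmn.eq_or_lt with rfl | hmn
      · simp [MapSequence.F_self]
      · refine le_trans (mul_le_mul_of_nonneg_right (Real.exp_le_exp.2 ?_) (norm_nonneg _))
          (H.expand_F hψ h4 ((hκγ.trans hγbar).trans hγ₀η) hs2 hmn hx hy)
        have hsum := sum_le_of_mem_averageTimes (a := S.lamE α βbar) hn hmn.le
        have hle : ∑ j ∈ Finset.Ico m n, S.lamE α βbar j ≤ ∑ j ∈ Finset.Ico m n, S.lu j :=
          Finset.sum_le_sum fun j _ => MapSequence.lamE_le_lu j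
        -- As `n - m ≥ 1`, the endpoint loss `2 * η` is at most `2 * η * (n - m)`, so the total loss
        -- is at most `3 * η` per step.
        have h0 : (1 : ℝ) ≤ (n : ℝ) - m := by
          have : (m : ℝ) + 1 ≤ n := by exact_mod_cast hmn
          linarith
        have h3η : 3 * η ≤ χuHat - χuBar := by nlinarith
        rw [Finset.sum_sub_distrib, Finset.sum_const, Nat.card_Ico, nsmul_eq_mul,
          Nat.cast_sub hmn.le]
        nlinarith
  · intro hχg ψ φ hψ hφ
    exact H.limsup_log_c0Dist_lt hψ hφ h4 hχg hη hη2 hr fun n hn => ⟨hn.1, hrad n hn⟩
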